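/- Let $X$ be a standard Borel space. A cost function on $X$ is a measurable $\rho : X\times X \to [0,\infty]$ with $\rho(x,x)=0$ for all $x$; its degree is $\sup_{x\in X} |\{y\in X : \rho(x,y)\neq\infty\}|$. For $S\in X^n$ let $\mathcal C_\rho(S)$ be the set of $S'\in X^n$ with $\frac1n\sum_{i=1}^n\rho(S_i,S'_i)\le 1$, and for a probability distribution $\mathcal D$ on $X$ let $\mathcal C_\rho(\mathcal D)$ be the set of distributions $\mathcal D'$ on $X$ for which some coupling of $x\sim\mathcal D$ and $x'\sim\mathcal D'$ satisfies $\mathbb E[\rho(x,x')]\le 1$. For a measurable, possibly randomized, $f:X^n\to\{0,1\}$ define $$\mathrm{Oblivious\text{-}Max}_\rho(f,\mathcal D)=\sup_{\mathcal D'\in\mathcal C_\rho(\mathcal D)}\Pr_{S\sim(\mathcal D')^n}[f(S)=1],\qquad \mathrm{Adaptive\text{-}Max}_\rho(f,\mathcal D)=\mathbb E_{S\sim\mathcal D^n}\Big[\sup_{S'\in\mathcal C_\rho(S)}\Pr[f(S')=1]\Big],$$ where the last probability is over the internal randomness of $f$ only. For $m\ge n$, let $\Phi_{m\to n}:X^m\to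 X^n$ be the randomized map that returns $n$ points of its input drawn uniformly without replacement (in random order). Theorem. There is an absolute constant $C>0$ such that the following holds for all natural numbers $n$, $d\ge 2$, all $\varepsilon>0$, and every integer $m\ge n$ with $m\ge C\,\frac{n^4(\ln d)^2}{\varepsilon^4}$. Let $X$ be a standard Borel space and $\rho$ a cost function on $X$ of degree $d$. 1. For every measurable $f:X^n\to\{0,1\}$ and every distribution $\mathcal D$ on $X$, $$\big|\mathrm{Oblivious\text{-}Max}_\rho(f,\mathcal D)-\mathrm{Adaptive\text{-}Max}_\rho(f\circ\Phi_{m\to n},\mathcal D)\big|\le\varepsilon.$$ 2. For every measurable space $Y$ and every (possibly randomized) algorithm $A:X^n\to Y$, i.e. every Markov kernel, $A$ in the presence of the $\rho$-oblivious adversary is $\varepsilon$-equivalent to $A\circ\Phi_{m\to n}$ in the presence of the $\rho$-adaptive adversary: for every measurable test $T:Y\to\{0,1\}$ and every distribution $\mathcal D$ on $X$, $$\big|\mathrm{Oblivious\text{-}Max}_\rho(T\circ A,\mathcal D)-\mathrm{Adaptive\text{-}Max}_\rho(T\circ A\circ\Phi_{m\to n},\mathcal D)\big|\le\varepsilon.$$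 -/

import Mathlib

open MeasureTheory ProbabilityTheory
open scoped ENNReal

namespace StatAdversary

/-- A cost function `ρ : X × X → [0, ∞]`: changing nothing is free. Joint measurability is what
makes the expected cost of a coupling meaningful. -/
structure IsCostFunction {X : Type*} [MeasurableSpace X] (ρ : X → X → ℝ≥0∞) : Prop where
  self_eq_zero : ∀ x, ρ x x = 0
  measurable : Measurable (Function.uncurry ρ)

/-- The degree of `ρ`: the supremum over `x` of the number of `y` with `ρ x y ≠ ∞`. -/
noncomputable def degree {X : Type*} (ρ : X → X → ℝ≥0∞) : ℕ∞ :=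
  ⨆ x : X, {y : X | ρ x y ≠ ∞}.encard

/-- The legal corruptions of a sample `S` of size `n`: the samples `S'` of the same size whose
average cost `(1/n) ∑ i, ρ (S i) (S' i)` is at most `1`. -/
def sampleCorruptions {X : Type*} (ρ : X → X → ℝ≥0∞) {n : ℕ} (S : Fin n → X) :
    Set (Fin n → X) :=
  {S' | (∑ i, ρ (S i) (S' i)) / (n : ℝ≥0∞) ≤ 1}

/-- The legal corruptions of a distribution `D`: all `D'` for which some coupling of `D` and `D'`
has expected cost at most `1`. (If `D` is a probability measure, so are the coupling and `D'`.) -/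
def distCorruptions {X : Type*} [MeasurableSpace X] (ρ : X → X → ℝ≥0∞) (D : Measure X) :
    Set (Measure X) :=
  {D' | ∃ π : Measure (X × X), π.map Prod.fst = D ∧ π.map Prod.snd = D' ∧
    ∫⁻ p, ρ p.1 p.2 ∂π ≤ 1}

/-- Maximum acceptance probability of the (possibly randomized) test `F` under the `ρ`-adaptive
adversary: the expectation, over an i.i.d. sample `S` from `D`, of the supremum over all legal
corruptions `S'` of `S` of the probability that `F` accepts `S'`. -/
noncomputable def adaptiveMax {X : Type*} [MeasurableSpace X] (ρ : X → X → ℝ≥0∞) {n : ℕ}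
    (F : Kernel (Fin n → X) Bool) (D : Measure X) : ℝ≥0∞ :=
  ∫⁻ S, (⨆ S' ∈ sampleCorruptions ρ S, F S' {true}) ∂(Measure.pi fun _ : Fin n => D)

/-- Maximum acceptance probability of the (possibly randomized) test `F` under the `ρ`-oblivious
adversary: the supremum over all legal corruptions `D'` of `D` of the probability that `F` accepts
an i.i.d. sample from `D'`. -/
noncomputable def obliviousMax {X : Type*} [MeasurableSpace X] (ρ : X → X → ℝ≥0∞) {n : ℕ}
    (F : Kernel (Fin n → X) Bool) (D : Measure X) : ℝ≥0∞ :=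
  ⨆ D' ∈ distCorruptions ρ D, ∫⁻ S, F S {true} ∂(Measure.pi fun _ : Fin n => D')

/-- The subsampling filter from `m` to `n` points: `n` points of the input drawn uniformly without
replacement, i.e. `S ∘ e` for a uniformly random injection `e` of the `n` positions into the `m`
positions. It is a probability kernel when `n ≤ m`. -/
noncomputable def subsample (X : Type*) [MeasurableSpace X] (m n : ℕ) :
    Kernel (Fin m → X) (Fin n → X) where
  toFun S := (Fintype.card (Fin n ↪ Fin m) : ℝ≥0∞)⁻¹ •
    ∑ e : Fin n ↪ Fin m, Measure.dirac (S ∘ e)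
  measurable' := by
    refine Measure.measurable_of_measurable_coe _ fun s hs => ?_
    simp only [Measure.smul_apply, Measure.finsetSum_apply, smul_eq_mul]
    refine Measurable.const_mul (Finset.measurable_sum _ fun e _ => ?_) _
    have h : Measurable fun S : Fin m → X => S ∘ e :=
      measurable_pi_lambda _ fun i => measurable_pi_apply (e i)
    exact (Measure.measurable_coe hs).comp (Measure.measurable_dirac.comp h)

/-- The (possibly randomized) algorithm `A` in the presence of the `ρ`-oblivious adversary is
`ε`-equivalent to `A'` in the presence of the `ρ`-adaptive adversary: no test `T` of the output
has maximum acceptance probabilities differing by more than `ε`, for any base distribution. -/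
def EpsEquivalent {X Y : Type*} [MeasurableSpace X] [MeasurableSpace Y] (ε : ℝ)
    (ρ : X → X → ℝ≥0∞) {n m : ℕ} (A : Kernel (Fin n → X) Y) (A' : Kernel (Fin m → X) Y) : Prop :=
  ∀ T : Y → Bool, Measurable T → ∀ D : Measure X, IsProbabilityMeasure D →
    |(obliviousMax ρ (A.map T) D).toReal - (adaptiveMax ρ (A'.map T) D).toReal| ≤ ε

end StatAdversary

namespace StatAdversary

set_option linter.unusedSectionVars false

/-! ### Product measures -/

section ProductMeasures

variable {Z : Type*} [MeasurableSpace Z]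

/-! Write `F` for the average of the acceptance probability `f` over ordered `n`-point subsamples of
an `m`-point sample; it is the acceptance probability of the subsampled test.

Oblivious ≤ adaptive (`lintegral_le_adaptive`). Let `D'` come from a coupling. Truncating its cost
at `L` and mixing in a fraction `δ` of the identity coupling changes the second marginal little, and
makes the cost bounded with mean at most `1 - δ`. By Chebyshev, `m` independent pairs then form a
legal corruption with high probability. The adaptive adversary can imitate this by drawing the
second coordinates given the first ones.

Adaptive ≤ oblivious (`adaptive_le_oblivious_add`). Since `ρ` has degree `d`, an optimal corruption
is a measurable labelling of the sample by `Fin d` (`exists_measurable_graph_cover`,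
`exists_measurable_optimal_labels`). Symmetrize the labelled sample. Its points are still i.i.d.
with law `D`, and its entropy relative to i.i.d. points with uniform labels is at most `m log d`,
each label contributing at most `log d`. The entropy of `k` components is convex in `k`, by
supermodularity and exchangeability (`entropy_supermodular`). Hence it is almost linear on one of
`J` consecutive blocks of length `n`: given some set `A` of at most `n * J` components, `n` further
ones have total correlation at most `2 n log d / J` (`exists_pinning`). By a Pinsker-type bound they
are nearly i.i.d. given `A`. It remains to compare the conditional law of one further component with
a legal corruption of `D`. The labels in `A` carry at most `|A| log d` of information about the
points outside `A`, shared equally among them, so a further point still has law close to `D`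
(`mul_entropy_increment_fst_le`). Legality of the sample bounds the conditional expected cost by `m
/ (m - |A|)` (`mul_lintegral_cost_le`). A small repair then gives a legal `D'`
(`exists_distCorruption_of_coupling`). Taking `J` of order `n log d / ε²`, the main error `n √(n J
log d / m)` is of order `ε` when `m` is of order `n⁴ (log d)² / ε⁴`. -/

theorem measurePreserving_pi_comp_injective {ι κ : Type*} [Fintype ι] [Fintype κ]
    (ν : Measure Z) [IsProbabilityMeasure ν] {e : κ → ι} (he : Function.Injective e) :
    MeasurePreserving (fun (ω : ι → Z) k => ω (e k))
      (Measure.pi fun _ => ν) (Measure.pi fun _ => ν) := by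
  refine ⟨by fun_prop, ?_⟩
  have h : iIndepFun (fun (i : ι) (ω : ι → Z) => ω i) (Measure.pi fun _ : ι => ν) :=
    iIndepFun_pi (μ := fun _ : ι => ν) (X := fun _ z => z) fun _ => aemeasurable_id
  have h' := h.precomp he
  rw [iIndepFun_iff_map_fun_eq_pi_map (fun i => (measurable_pi_apply _).aemeasurable)] at h'
  simp only [(measurePreserving_eval (fun _ : ι => ν) _).map_eq] at h'
  exact h'

theorem lintegral_pi_succ {n : ℕ} (μ : Measure Z) [SigmaFinite μ]
    {f : (Fin (n + 1) → Z) → ℝ≥0∞} (hf : Measurable f) :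
    ∫⁻ w, f w ∂(Measure.pi fun _ => μ) =
      ∫⁻ x, ∫⁻ y, f (Fin.cons x y) ∂(Measure.pi fun _ : Fin n => μ) ∂μ := by
  have h := (measurePreserving_piFinSuccAbove (fun _ : Fin (n + 1) => μ) 0).symm
  have hm := (MeasurableEquiv.piFinSuccAbove (fun _ : Fin (n + 1) => Z) 0).symm.measurable
  have hfm : Measurable fun a =>
      f ((MeasurableEquiv.piFinSuccAbove (fun _ : Fin (n + 1) => Z) 0).symm a) := hf.comp hm
  rw [← h.lintegral_comp hf, lintegral_prod _ hfm.aemeasurable]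
  simp [MeasurableEquiv.piFinSuccAbove, Fin.insertNthEquiv]

theorem measurable_fin_cons {n : ℕ} :
    Measurable fun p : Z × (Fin n → Z) => (Fin.cons p.1 p.2 : Fin (n + 1) → Z) := by
  refine measurable_pi_lambda _ fun i => ?_
  refine Fin.cases ?_ (fun j => ?_) i
  · simpa using measurable_fst
  · simp only [Fin.cons_succ]; fun_prop

theorem lintegral_pi_withDensity {n : ℕ} (ν : Measure Z) [SigmaFinite ν] {p : Z → ℝ≥0∞}
    (hp : Measurable p) [IsFiniteMeasure (ν.withDensity p)]
    {f : (Fin n → Z) → ℝ≥0∞} (hf : Measurable f) :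
    ∫⁻ w, f w ∂(Measure.pi fun _ => ν.withDensity p) =
      ∫⁻ w, (∏ j, p (w j)) * f w ∂(Measure.pi fun _ => ν) := by
  induction n with
  | zero => simp [Measure.pi_of_empty (x := Fin.elim0)]
  | succ n ih =>
    have hF : Measurable fun w : Fin (n + 1) → Z => (∏ j, p (w j)) * f w := by fun_prop
    rw [lintegral_pi_succ _ hf, lintegral_pi_succ _ hF]
    have hfc : Measurable fun q : Z × (Fin n → Z) => f (Fin.cons q.1 q.2) :=
      hf.comp measurable_fin_cons
    have hfx (x : Z) : Measurable fun y : Fin n → Z => f (Fin.cons x y) :=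
      hfc.comp measurable_prodMk_left
    have hpp : Measurable fun y : Fin n → Z => ∏ j, p (y j) := by fun_prop
    rw [lintegral_withDensity_eq_lintegral_mul _ hp hfc.lintegral_prod_right']
    refine lintegral_congr fun x => ?_
    simp only [Pi.mul_apply, Fin.prod_univ_succ, Fin.cons_zero, Fin.cons_succ]
    simp only [mul_assoc]
    rw [ih (hfx x), lintegral_const_mul _ (by exact hpp.mul (hfx x))]

/-- If `μ₁` exceeds `μ₂` by at most `η` on `[0, 1]`-valued functions, then its `n`-th power
exceeds that of `μ₂` by at most `n * η`. -/
theorem lintegral_pi_le_add {μ₁ μ₂ : Measure Z} [IsProbabilityMeasure μ₁]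
    [IsProbabilityMeasure μ₂] {η : ℝ≥0∞}
    (h : ∀ g : Z → ℝ≥0∞, Measurable g → (∀ z, g z ≤ 1) → ∫⁻ z, g z ∂μ₁ ≤ ∫⁻ z, g z ∂μ₂ + η)
    {n : ℕ} {f : (Fin n → Z) → ℝ≥0∞} (hf : Measurable f) (hf1 : ∀ w, f w ≤ 1) :
    ∫⁻ w, f w ∂(Measure.pi fun _ => μ₁) ≤ ∫⁻ w, f w ∂(Measure.pi fun _ => μ₂) + n * η := by
  induction n with
  | zero => simp [Measure.pi_of_empty (x := Fin.elim0)]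
  | succ n ih =>
    have hfc : Measurable fun q : Z × (Fin n → Z) => f (Fin.cons q.1 q.2) :=
      hf.comp measurable_fin_cons
    have hfx (x : Z) : Measurable fun y : Fin n → Z => f (Fin.cons x y) :=
      hfc.comp measurable_prodMk_left
    rw [lintegral_pi_succ _ hf, lintegral_pi_succ _ hf]
    -- Hybrid argument: the tail is switched to `μ₂` by induction, then the head by `h`, each
    -- coordinate costing `η`.
    calc ∫⁻ x, ∫⁻ y, f (Fin.cons x y) ∂(Measure.pi fun _ => μ₁) ∂μ₁
        ≤ ∫⁻ x, (∫⁻ y, f (Fin.cons x y) ∂(Measure.pi fun _ => μ₂) + n * η) ∂μ₁ :=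
          lintegral_mono fun x => ih (hfx x) fun _ => hf1 _
      _ = ∫⁻ x, ∫⁻ y, f (Fin.cons x y) ∂(Measure.pi fun _ => μ₂) ∂μ₁ + n * η := by
          rw [lintegral_add_right _ measurable_const]; simp
      _ ≤ ∫⁻ x, ∫⁻ y, f (Fin.cons x y) ∂(Measure.pi fun _ => μ₂) ∂μ₂ + η + n * η := by
          gcongr
          refine h _ hfc.lintegral_prod_right' fun x => ?_
          calc ∫⁻ y, f (Fin.cons x y) ∂(Measure.pi fun _ => μ₂)
              ≤ ∫⁻ y, 1 ∂(Measure.pi fun _ => μ₂) := lintegral_mono fun _ => hf1 _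
            _ = 1 := by simp
      _ = _ := by push_cast; ring

end ProductMeasures

/-! ### Pinsker-type and Gibbs inequalities for a likelihood ratio -/

section Ratio

/-- With `s = √r`, the bound `log s ≤ s - 1` gives `(1 - s)² ≤ -log r - 1 + r`. Then `1 - r = (1 -
s)(1 + s)` is split by the arithmetic-geometric mean inequality with weight `t`, using `(1 + s)² ≤
2(1 + r)`. -/
theorem ofReal_one_sub_le {r t : ℝ} (hr : 0 < r) (ht : 0 < t) :
    max (1 - r) 0 ≤ (-Real.log r - 1 + r) / t + t * (1 + r) / 2 := by
  have hlog : Real.log r ≤ r - 1 := Real.log_le_sub_one_of_pos hr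
  have h0 : 0 ≤ (-Real.log r - 1 + r) / t := div_nonneg (by linarith) ht.le
  refine max_le ?_ (by positivity)
  set s := Real.sqrt r with hs
  have hs0 : 0 < s := Real.sqrt_pos.2 hr
  have hrs : r = s ^ 2 := (Real.sq_sqrt hr.le).symm
  have hl : Real.log r ≤ 2 * (s - 1) := by
    rw [hrs, Real.log_pow]
    have := Real.log_le_sub_one_of_pos hs0
    push_cast; linarith
  have h1 : (1 - s) ^ 2 / t ≤ (-Real.log r - 1 + r) / t := by
    gcongr; nlinarith
  have h2 : 1 - r ≤ (1 - s) ^ 2 / t + t * (1 + r) / 2 := by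
    have h3 : (1 - s) ^ 2 / t + t * (1 + r) / 2 - (1 - r)
        = ((1 - s) - t * (1 + s) / 2) ^ 2 / t + t * (1 - s) ^ 2 / 4 := by
      rw [hrs]; field_simp; ring
    have h4 : 0 ≤ ((1 - s) - t * (1 + s) / 2) ^ 2 / t + t * (1 - s) ^ 2 / 4 := by positivity
    linarith
  linarith

variable {Ω : Type*} [MeasurableSpace Ω] {μ : Measure Ω} [IsProbabilityMeasure μ]

/-- A one-sided Pinsker inequality: the integral of `-log r` is a relative entropy, and the best `t`
is of the order of its square root. Leaving `t` free avoids square roots. After integrating the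
pointwise bound, `∫ r ≤ 1` removes `-1 + r` and bounds the last term by `t`. -/
theorem lintegral_one_sub_le_of_log {r : Ω → ℝ≥0∞} (hr : Measurable r)
    (hr1 : ∫⁻ ω, r ω ∂μ ≤ 1) (hr0 : ∀ᵐ ω ∂μ, r ω ≠ 0)
    (hlog : Integrable (fun ω => Real.log (r ω).toReal) μ) {t : ℝ} (ht : 0 < t) :
    ∫⁻ ω, (1 - r ω) ∂μ ≤ ENNReal.ofReal ((∫ ω, -Real.log (r ω).toReal ∂μ) / t + t) := by
  have hfin : ∀ᵐ ω ∂μ, r ω < ∞ :=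
    ae_lt_top hr (ne_top_of_le_ne_top ENNReal.one_ne_top hr1)
  have hint : Integrable (fun ω => (r ω).toReal) μ :=
    integrable_toReal_of_lintegral_ne_top hr.aemeasurable
      (ne_top_of_le_ne_top ENNReal.one_ne_top hr1)
  have hE : ∫ ω, (r ω).toReal ∂μ ≤ 1 := by
    rw [integral_toReal hr.aemeasurable hfin]
    exact ENNReal.toReal_mono ENNReal.one_ne_top hr1
  set G : Ω → ℝ := fun ω => (-Real.log (r ω).toReal - 1 + (r ω).toReal) / t +
    t * (1 + (r ω).toReal) / 2 with hG
  have hlog' : Integrable (fun ω => -Real.log (r ω).toReal) μ := hlog.neg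
  have hGi : Integrable G μ := by
    refine Integrable.add (((hlog'.sub (integrable_const 1)).add hint).div_const t) ?_
    exact (((integrable_const (1 : ℝ)).add hint).const_mul t).div_const 2
  have hpt : ∀ᵐ ω ∂μ, 1 - r ω ≤ ENNReal.ofReal (G ω) ∧ 0 ≤ G ω := by
    filter_upwards [hfin, hr0] with ω h1 h2
    have hpos : 0 < (r ω).toReal := ENNReal.toReal_pos h2 h1.ne
    have hm := ofReal_one_sub_le hpos ht
    refine ⟨?_, (le_max_right _ _).trans hm⟩
    rw [← ENNReal.ofReal_toReal h1.ne, ← ENNReal.ofReal_one,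
      ← ENNReal.ofReal_sub _ ENNReal.toReal_nonneg]
    exact ENNReal.ofReal_le_ofReal ((le_max_left _ _).trans hm)
  calc ∫⁻ ω, (1 - r ω) ∂μ ≤ ∫⁻ ω, ENNReal.ofReal (G ω) ∂μ :=
        lintegral_mono_ae (hpt.mono fun _ h => h.1)
    _ = ENNReal.ofReal (∫ ω, G ω ∂μ) :=
        (ofReal_integral_eq_lintegral_ofReal hGi (hpt.mono fun _ h => h.2)).symm
    _ ≤ _ := by
        refine ENNReal.ofReal_le_ofReal ?_
        have h1 : ∫ ω, G ω ∂μ = ((∫ ω, -Real.log (r ω).toReal ∂μ) - 1 + ∫ ω, (r ω).toReal ∂μ) / t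
            + t * (1 + ∫ ω, (r ω).toReal ∂μ) / 2 := by
          have e1 : Integrable (fun ω => -Real.log (r ω).toReal - 1) μ :=
            hlog'.sub (integrable_const 1)
          have e2 : Integrable (fun ω => -Real.log (r ω).toReal - 1 + (r ω).toReal) μ :=
            e1.add hint
          have e3 : Integrable (fun ω => 1 + (r ω).toReal) μ := (integrable_const (1 : ℝ)).add hint
          rw [hG, integral_add (e2.div_const t) ((e3.const_mul t).div_const 2),
            integral_div, integral_div, integral_const_mul, integral_add e1 hint,
            integral_sub hlog' (integrable_const 1), integral_add (integrable_const _) hint]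
          simp
        rw [h1]
        have h2 : ((∫ ω, -Real.log (r ω).toReal ∂μ) - 1 + ∫ ω, (r ω).toReal ∂μ) / t ≤
            (∫ ω, -Real.log (r ω).toReal ∂μ) / t := by gcongr; linarith
        have h3 : t * (1 + ∫ ω, (r ω).toReal ∂μ) / 2 ≤ t := by nlinarith
        linarith

theorem integral_log_nonpos {r : Ω → ℝ≥0∞} (hr : Measurable r)
    (hr1 : ∫⁻ ω, r ω ∂μ ≤ 1) (hr0 : ∀ᵐ ω ∂μ, r ω ≠ 0)
    (hlog : Integrable (fun ω => Real.log (r ω).toReal) μ) :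
    ∫ ω, Real.log (r ω).toReal ∂μ ≤ 0 := by
  have hfin : ∀ᵐ ω ∂μ, r ω < ∞ :=
    ae_lt_top hr (ne_top_of_le_ne_top ENNReal.one_ne_top hr1)
  have hint : Integrable (fun ω => (r ω).toReal) μ :=
    integrable_toReal_of_lintegral_ne_top hr.aemeasurable
      (ne_top_of_le_ne_top ENNReal.one_ne_top hr1)
  have hE : ∫ ω, (r ω).toReal ∂μ ≤ 1 := by
    rw [integral_toReal hr.aemeasurable hfin]
    exact ENNReal.toReal_mono ENNReal.one_ne_top hr1
  have h : ∫ ω, Real.log (r ω).toReal ∂μ ≤ ∫ ω, ((r ω).toReal - 1) ∂μ := by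
    refine integral_mono_ae hlog (hint.sub (integrable_const 1)) ?_
    filter_upwards [hfin, hr0] with ω h1 h2
    exact Real.log_le_sub_one_of_pos (ENNReal.toReal_pos h2 h1.ne)
  rw [integral_sub hint (integrable_const 1)] at h
  simp at h; linarith

end Ratio

/-! ### Legal corruptions of a distribution -/

section Corruptions

variable {X : Type*} [MeasurableSpace X] {ρ : X → X → ℝ≥0∞}

theorem isProbabilityMeasure_of_map {A B : Type*} [MeasurableSpace A] [MeasurableSpace B]
    {f : A → B} (hf : Measurable f) {π : Measure A} [h : IsProbabilityMeasure (π.map f)] :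
    IsProbabilityMeasure π := by
  refine ⟨?_⟩
  have := h.measure_univ
  rwa [Measure.map_apply hf MeasurableSet.univ, Set.preimage_univ] at this

theorem isProbabilityMeasure_of_mem_distCorruptions {D D' : Measure X} [IsProbabilityMeasure D]
    (h : D' ∈ distCorruptions ρ D) : IsProbabilityMeasure D' := by
  obtain ⟨π, rfl, rfl, -⟩ := h
  have := isProbabilityMeasure_of_map (π := π) measurable_fst
  exact Measure.isProbabilityMeasure_map measurable_snd.aemeasurable

theorem self_mem_distCorruptions (hρ : IsCostFunction ρ) (D : Measure X) :
    D ∈ distCorruptions ρ D := by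
  have hd : Measurable fun x : X => (x, x) := by fun_prop
  refine ⟨D.map fun x => (x, x), ?_, ?_, ?_⟩
  · rw [Measure.map_map measurable_fst hd]; exact Measure.map_id
  · rw [Measure.map_map measurable_snd hd]; exact Measure.map_id
  · have h := lintegral_map (μ := D) hρ.measurable hd
    simp only [Function.uncurry, hρ.self_eq_zero, lintegral_zero] at h
    rw [h]; exact zero_le

theorem self_mem_sampleCorruptions (hρ : IsCostFunction ρ) {n : ℕ} (S : Fin n → X) :
    S ∈ sampleCorruptions ρ S := by
  simp [sampleCorruptions, hρ.self_eq_zero]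

/-- A sub-coupling `Γ` whose first marginal has density `s` with respect to `D` is turned into a
legal corruption of `D`, by capping the density of the first marginal, and then reverting a
fraction `τ` of the mass. -/
theorem exists_distCorruption_of_coupling (hρ : IsCostFunction ρ) {D : Measure X}
    [IsProbabilityMeasure D] (Γ : Measure (X × X)) {s : X → ℝ≥0∞} (hs : Measurable s)
    (hfst : Γ.map Prod.fst = D.withDensity s) {τ : ℝ≥0∞} (hτ : τ ≤ 1)
    (hcost : (1 - τ) * ∫⁻ p, ρ p.1 p.2 ∂Γ ≤ 1) :
    ∃ D' ∈ distCorruptions ρ D, ∀ h : X → ℝ≥0∞, Measurable h → (∀ x, h x ≤ 1) →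
      ∫⁻ p, h p.2 ∂Γ ≤ ∫⁻ x, h x ∂D' + (∫⁻ x, (s x - 1) ∂D + τ) := by
  -- `w x` is the fraction of the mass above `x` that is kept: `min 1 (s x)⁻¹` caps the first
  -- marginal at `D`, and `1 - τ` brings the cost down to `1`.
  set w : X → ℝ≥0∞ := fun x => (1 - τ) * min 1 (s x)⁻¹ with hwdef
  have hw : Measurable w := by fun_prop
  have hw1 (x) : w x ≤ 1 := mul_le_one' tsub_le_self (min_le_left _ _)
  have hws (x) : w x * s x ≤ 1 := by
    calc w x * s x ≤ 1 * (s x)⁻¹ * s x := by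
          simp only [hwdef]; gcongr
          · exact tsub_le_self
          · exact min_le_right _ _
      _ ≤ 1 := by rw [one_mul]; exact ENNReal.inv_mul_le_one _
  have hsw (x) : s x * (1 - w x) ≤ (s x - 1) + τ := by
    rcases eq_or_ne (s x) ∞ with h | h
    · simp [h]
    rcases le_or_gt (s x) 1 with h1 | h1
    · have : w x = 1 - τ := by
        simp only [hwdef]
        rw [min_eq_left (ENNReal.one_le_inv.2 h1), mul_one]
      rw [this, ENNReal.sub_sub_cancel ENNReal.one_ne_top hτ]
      calc s x * τ ≤ 1 * τ := by gcongr
        _ ≤ _ := by rw [one_mul]; exact le_add_self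
    · have h0 : s x ≠ 0 := (zero_lt_one.trans h1).ne'
      have : w x = (1 - τ) * (s x)⁻¹ := by
        simp only [hwdef]
        rw [min_eq_right (ENNReal.inv_le_one.2 h1.le)]
      rw [this, ENNReal.mul_sub (fun _ _ => h), mul_one, mul_comm (1 - τ), ← mul_assoc,
        ENNReal.mul_inv_cancel h0 h, one_mul]
      rw [tsub_le_iff_right]
      calc s x = (s x - 1) + 1 := (tsub_add_cancel_of_le h1.le).symm
        _ = (s x - 1) + (τ + (1 - τ)) := by rw [add_tsub_cancel_of_le hτ]
        _ ≤ s x - 1 + τ + (1 - τ) := by rw [add_assoc]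
  have hd : Measurable fun x : X => (x, x) := by fun_prop
  -- The missing part of the first marginal is put back on the diagonal, where it costs nothing.
  set Γ' : Measure (X × X) := Γ.withDensity (fun p => w p.1) +
    (D.withDensity fun x => 1 - w x * s x).map (fun x => (x, x)) with hΓ'
  have hint {g : X × X → ℝ≥0∞} (hg : Measurable g) :
      ∫⁻ p, g p ∂Γ' = ∫⁻ p, w p.1 * g p ∂Γ + ∫⁻ x, (1 - w x * s x) * g (x, x) ∂D := by
    rw [hΓ', lintegral_add_measure, lintegral_map hg hd,
      lintegral_withDensity_eq_lintegral_mul _ (by fun_prop) hg,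
      lintegral_withDensity_eq_lintegral_mul _ (by fun_prop) (by fun_prop)]
    rfl
  have hmar {g : X → ℝ≥0∞} (hg : Measurable g) :
      ∫⁻ p, g p.1 ∂Γ = ∫⁻ x, s x * g x ∂D := by
    rw [← lintegral_map hg measurable_fst, hfst,
      lintegral_withDensity_eq_lintegral_mul _ hs hg]
    rfl
  have hu : Measurable (fun p : X × X => ρ p.1 p.2) := hρ.measurable
  refine ⟨Γ'.map Prod.snd, ⟨Γ', ?_, rfl, ?_⟩, ?_⟩
  · refine Measure.ext_of_lintegral _ fun g hg => ?_
    rw [lintegral_map hg measurable_fst, hint (by fun_prop),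
      hmar (g := fun x => w x * g x) (by fun_prop), ← lintegral_add_left (by fun_prop)]
    refine lintegral_congr fun x => ?_
    rw [← mul_assoc, ← add_mul, mul_comm (s x), add_tsub_cancel_of_le (hws x), one_mul]
  · rw [hint hu]
    simp only [hρ.self_eq_zero, mul_zero, lintegral_zero, add_zero]
    refine le_trans ?_ hcost
    rw [← lintegral_const_mul _ hu]
    refine lintegral_mono fun p => ?_
    gcongr
    calc w p.1 ≤ (1 - τ) * 1 := by simp only [hwdef]; gcongr; exact min_le_left _ _
      _ = _ := mul_one _
  · intro h hh hh1
    rw [lintegral_map hh measurable_snd, hint (by fun_prop)]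
    calc ∫⁻ p, h p.2 ∂Γ ≤ ∫⁻ p, (w p.1 * h p.2 + (1 - w p.1)) ∂Γ := by
          refine lintegral_mono fun p => ?_
          calc h p.2 = w p.1 * h p.2 + (1 - w p.1) * h p.2 := by
                rw [← add_mul, add_tsub_cancel_of_le (hw1 _), one_mul]
            _ ≤ w p.1 * h p.2 + (1 - w p.1) * 1 := by gcongr; exact hh1 _
            _ = _ := by rw [mul_one]
      _ = ∫⁻ p, w p.1 * h p.2 ∂Γ + ∫⁻ x, s x * (1 - w x) ∂D := by
          rw [lintegral_add_left (by fun_prop), hmar (g := fun x => 1 - w x) (by fun_prop)]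
      _ ≤ ∫⁻ p, w p.1 * h p.2 ∂Γ + (∫⁻ x, (s x - 1) ∂D + τ) := by
          gcongr
          calc ∫⁻ x, s x * (1 - w x) ∂D ≤ ∫⁻ x, ((s x - 1) + τ) ∂D := lintegral_mono hsw
            _ = _ := by rw [lintegral_add_right _ measurable_const]; simp
      _ ≤ _ := by gcongr; exact le_self_add

end Corruptions

/-! ### Averages over subsamples -/

section Subsampling

variable {X : Type*}

/-- The average of `f` over the ordered `n`-point subsamples of an `m`-point sample. -/
noncomputable def subsampleAverage {n : ℕ} (m : ℕ) (f : (Fin n → X) → ℝ≥0∞) (S : Fin m → X) :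
    ℝ≥0∞ :=
  (Fintype.card (Fin n ↪ Fin m) : ℝ≥0∞)⁻¹ * ∑ e : Fin n ↪ Fin m, f (S ∘ e)

variable {n m : ℕ} {f : (Fin n → X) → ℝ≥0∞}

theorem card_embedding_ne_zero (hnm : n ≤ m) : (Fintype.card (Fin n ↪ Fin m) : ℝ≥0∞) ≠ 0 := by
  have : Nonempty (Fin n ↪ Fin m) := ⟨Fin.castLEEmb hnm⟩
  exact Nat.cast_ne_zero.2 Fintype.card_ne_zero

theorem subsampleAverage_const (hnm : n ≤ m) {S : Fin m → X} {c : ℝ≥0∞}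
    (h : ∀ e : Fin n ↪ Fin m, f (S ∘ e) = c) : subsampleAverage m f S = c := by
  simp only [subsampleAverage, h, Finset.sum_const, nsmul_eq_mul, Finset.card_univ]
  rw [← mul_assoc, ENNReal.inv_mul_cancel (card_embedding_ne_zero hnm) (ENNReal.natCast_ne_top _),
    one_mul]

theorem subsampleAverage_le_one (hf1 : ∀ S, f S ≤ 1) (S : Fin m → X) :
    subsampleAverage m f S ≤ 1 := by
  calc subsampleAverage m f S
      ≤ (Fintype.card (Fin n ↪ Fin m) : ℝ≥0∞)⁻¹ * ∑ _e : Fin n ↪ Fin m, 1 := by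
        unfold subsampleAverage; gcongr; exact hf1 _
    _ ≤ 1 := by simp [ENNReal.inv_mul_le_one]

variable [MeasurableSpace X]

theorem measurable_comp_index {κ ι : Type*} (e : κ → ι) :
    Measurable fun S : ι → X => S ∘ e :=
  measurable_pi_lambda _ fun i => measurable_pi_apply (e i)

theorem measurable_subsampleAverage (hf : Measurable f) :
    Measurable (subsampleAverage m f) := by
  have hfe (e : Fin n ↪ Fin m) : Measurable fun S : Fin m → X => f (S ∘ e) :=
    hf.comp (measurable_comp_index e)
  have := Finset.measurable_fun_sum (Finset.univ : Finset (Fin n ↪ Fin m)) fun e _ => hfe e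
  exact this.const_mul _

theorem lintegral_subsampleAverage (hnm : n ≤ m) (hf : Measurable f) {μ : Measure (Fin m → X)}
    {c : ℝ≥0∞} (h : ∀ e : Fin n ↪ Fin m, ∫⁻ S, f (S ∘ e) ∂μ = c) :
    ∫⁻ S, subsampleAverage m f S ∂μ = c := by
  have hfe (e : Fin n ↪ Fin m) : Measurable fun S : Fin m → X => f (S ∘ e) :=
    hf.comp (measurable_comp_index e)
  unfold subsampleAverage
  rw [lintegral_const_mul _ (Finset.measurable_fun_sum _ fun e _ => hfe e),
    lintegral_finsetSum _ fun e _ => hfe e]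
  simp only [h, Finset.sum_const, nsmul_eq_mul, Finset.card_univ]
  rw [← mul_assoc, ENNReal.inv_mul_cancel (card_embedding_ne_zero hnm) (ENNReal.natCast_ne_top _),
    one_mul]

theorem lintegral_pi_subsampleAverage (hnm : n ≤ m) (hf : Measurable f) (D : Measure X)
    [IsProbabilityMeasure D] :
    ∫⁻ S, subsampleAverage m f S ∂(Measure.pi fun _ => D) =
      ∫⁻ S, f S ∂(Measure.pi fun _ => D) :=
  lintegral_subsampleAverage hnm hf fun e =>
    (measurePreserving_pi_comp_injective D e.injective).lintegral_comp hf

theorem subsample_lintegral (hf : Measurable f) (S : Fin m → X) :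
    ∫⁻ S', f S' ∂(subsample X m n S) = subsampleAverage m f S := by
  change ∫⁻ S', f S' ∂((Fintype.card (Fin n ↪ Fin m) : ℝ≥0∞)⁻¹ •
    ∑ e : Fin n ↪ Fin m, Measure.dirac (S ∘ e)) = _
  rw [lintegral_smul_measure, lintegral_finsetSum_measure]
  simp [subsampleAverage, lintegral_dirac' _ hf]

end Subsampling

/-! ### The oblivious value is at most the adaptive value, up to error -/

section ObliviousLeAdaptive

theorem mem_sampleCorruptions_iff {X : Type*} {ρ : X → X → ℝ≥0∞} {m : ℕ} (hm : 0 < m)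
    {S S' : Fin m → X} :
    S' ∈ sampleCorruptions ρ S ↔ ∑ i, ρ (S i) (S' i) ≤ m := by
  rw [sampleCorruptions, Set.mem_ofPred_eq, ENNReal.div_le_iff (by positivity) (by simp), one_mul]

variable {X : Type*} [MeasurableSpace X] {ρ : X → X → ℝ≥0∞}

/-- Any legal corruption is close to one coming from a coupling with bounded cost and slack in
its expected cost. -/
theorem exists_bounded_coupling (hρ : IsCostFunction ρ) {D D' : Measure X}
    [IsProbabilityMeasure D] (h : D' ∈ distCorruptions ρ D) {δ L : ℝ} (hδ : 0 < δ) (hδ1 : δ ≤ 1)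
    (hL : 0 < L) :
    ∃ π : Measure (X × X), π.map Prod.fst = D ∧
      (∀ᵐ p ∂π, ρ p.1 p.2 ≤ ENNReal.ofReal L) ∧
      ∫⁻ p, ρ p.1 p.2 ∂π ≤ ENNReal.ofReal (1 - δ) ∧
      ∀ g : X → ℝ≥0∞, Measurable g → (∀ x, g x ≤ 1) →
        ∫⁻ x, g x ∂D' ≤ ∫⁻ p, g p.2 ∂π + ENNReal.ofReal (δ + 1 / L) := by
  obtain ⟨π, h1, h2, h3⟩ := h
  have hu : Measurable (fun p : X × X => ρ p.1 p.2) := hρ.measurable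
  have hd : Measurable fun x : X => (x, x) := by fun_prop
  set B : Set (X × X) := {p | ρ p.1 p.2 ≤ ENNReal.ofReal L} with hB
  have hBm : MeasurableSet B := measurableSet_le hu measurable_const
  classical
  -- Pairs costing more than `L` are moved to the diagonal; by Markov their mass is at most `1 / L`.
  set t : X × X → X × X := fun p => (p.1, if p ∈ B then p.2 else p.1) with ht
  have htm : Measurable t :=
    measurable_fst.prodMk (Measurable.ite hBm measurable_snd measurable_fst)
  have htρ (p) : ρ (t p).1 (t p).2 ≤ ENNReal.ofReal L ∧ ρ (t p).1 (t p).2 ≤ ρ p.1 p.2 := by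
    by_cases hp : p ∈ B
    · have : t p = p := by simp [ht, hp]
      rw [this]; exact ⟨hp, le_rfl⟩
    · have : ρ (t p).1 (t p).2 = 0 := by simp [ht, hp, hρ.self_eq_zero]
      rw [this]; exact ⟨zero_le, zero_le⟩
  have hadd : ENNReal.ofReal (1 - δ) + ENNReal.ofReal δ = 1 := by
    rw [← ENNReal.ofReal_add (by linarith) hδ.le]; simp
  have hint {g : X × X → ℝ≥0∞} (hg : Measurable g) :
      ∫⁻ p, g p ∂(ENNReal.ofReal (1 - δ) • π.map t + ENNReal.ofReal δ • D.map fun x => (x, x)) =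
        ENNReal.ofReal (1 - δ) * ∫⁻ p, g (t p) ∂π + ENNReal.ofReal δ * ∫⁻ x, g (x, x) ∂D := by
    rw [lintegral_add_measure, lintegral_smul_measure, lintegral_smul_measure,
      lintegral_map hg htm, lintegral_map hg hd]
    rfl
  refine ⟨ENNReal.ofReal (1 - δ) • π.map t + ENNReal.ofReal δ • D.map fun x => (x, x),
    ?_, ?_, ?_, ?_⟩
  · refine Measure.ext_of_lintegral _ fun g hg => ?_
    rw [lintegral_map hg measurable_fst, hint (by fun_prop)]
    have : ∫⁻ p, g (t p).1 ∂π = ∫⁻ x, g x ∂D := by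
      rw [← h1, lintegral_map hg measurable_fst]
    rw [this, ← add_mul, hadd, one_mul]
  · rw [ae_iff]
    simp only [not_le]
    have hm : MeasurableSet {p : X × X | ENNReal.ofReal L < ρ p.1 p.2} :=
      measurableSet_lt measurable_const hu
    have e1 : t ⁻¹' {p | ENNReal.ofReal L < ρ p.1 p.2} = ∅ := by
      ext p; simpa using (htρ p).1
    have e2 : (fun x : X => (x, x)) ⁻¹' {p | ENNReal.ofReal L < ρ p.1 p.2} = ∅ := by
      ext p; simp [hρ.self_eq_zero]
    simp only [Measure.add_apply, Measure.smul_apply, Measure.map_apply htm hm,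
      Measure.map_apply hd hm, e1, e2]
    simp
  · rw [hint hu]
    simp only [hρ.self_eq_zero, lintegral_zero, mul_zero, add_zero]
    calc ENNReal.ofReal (1 - δ) * ∫⁻ p, ρ (t p).1 (t p).2 ∂π
        ≤ ENNReal.ofReal (1 - δ) * 1 := by
          gcongr
          exact (lintegral_mono fun p => (htρ p).2).trans h3
      _ = _ := mul_one _
  · intro g hg hg1
    have hprob := isProbabilityMeasure_of_map (π := π) measurable_fst (h := by rw [h1]; assumption)
    have hbad : π Bᶜ ≤ ENNReal.ofReal (1 / L) := by
      calc π Bᶜ ≤ π {p | ENNReal.ofReal L ≤ ρ p.1 p.2} :=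
            measure_mono fun p hp => by simp [hB] at hp; exact hp.le
        _ ≤ (∫⁻ p, ρ p.1 p.2 ∂π) / ENNReal.ofReal L :=
            meas_ge_le_lintegral_div hu.aemeasurable (by simpa using hL) ENNReal.ofReal_ne_top
        _ ≤ 1 / ENNReal.ofReal L := by gcongr
        _ = _ := by rw [ENNReal.ofReal_div_of_pos hL]; simp
    rw [hint (g := fun p => g p.2) (by fun_prop), ← h2, lintegral_map hg measurable_snd,
      ENNReal.ofReal_add hδ.le (by positivity)]
    have hsplit : ∫⁻ p, g p.2 ∂π ≤ ∫⁻ p, g (t p).2 ∂π + π Bᶜ := by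
      rw [← lintegral_indicator_one hBm.compl, ← lintegral_add_left (by fun_prop)]
      refine lintegral_mono fun p => ?_
      by_cases hp : p ∈ B
      · simp [ht, hp]
      · simp only [ht, hp, if_false, Set.indicator_of_mem (Set.mem_compl hp), Pi.one_apply]
        exact (hg1 _).trans le_add_self
    have hle1 : ∫⁻ p, g (t p).2 ∂π ≤ 1 := by
      calc _ ≤ ∫⁻ _, 1 ∂π := lintegral_mono fun _ => hg1 _
        _ = 1 := by simp
    calc ∫⁻ p, g p.2 ∂π ≤ ∫⁻ p, g (t p).2 ∂π + π Bᶜ := hsplit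
      _ = ENNReal.ofReal (1 - δ) * ∫⁻ p, g (t p).2 ∂π +
          ENNReal.ofReal δ * ∫⁻ p, g (t p).2 ∂π + π Bᶜ := by rw [← add_mul, hadd, one_mul]
      _ ≤ ENNReal.ofReal (1 - δ) * ∫⁻ p, g (t p).2 ∂π +
          ENNReal.ofReal δ * 1 + ENNReal.ofReal (1 / L) := by gcongr
      _ ≤ _ := by
          rw [mul_one, add_assoc]
          gcongr
          exact le_self_add

theorem measurableSet_legal (hρ : IsCostFunction ρ) (m : ℕ) :
    MeasurableSet {q : (Fin m → X) × (Fin m → X) | q.2 ∈ sampleCorruptions ρ q.1} := by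
  have h : Measurable fun q : (Fin m → X) × (Fin m → X) => ∑ i, ρ (q.1 i) (q.2 i) := by
    refine Finset.measurable_fun_sum _ fun i _ => ?_
    exact hρ.measurable.comp (f := fun q : (Fin m → X) × (Fin m → X) => (q.1 i, q.2 i))
      (by fun_prop)
  exact measurableSet_le (h.div_const _) measurable_const

/-- Chebyshev for the total cost of `m` independent pairs: a `[0, L]`-valued cost with mean at most
`1` has variance at most `L`, and illegality forces the total to exceed its mean by at least `δ *
m`. -/
theorem measure_illegal_le (hρ : IsCostFunction ρ) {π : Measure (X × X)} [IsProbabilityMeasure π]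
    {δ L : ℝ} (hδ : 0 < δ) (hL : 0 < L) (hδ1 : δ ≤ 1)
    (hbd : ∀ᵐ p ∂π, ρ p.1 p.2 ≤ ENNReal.ofReal L)
    (hmean : ∫⁻ p, ρ p.1 p.2 ∂π ≤ ENNReal.ofReal (1 - δ)) {m : ℕ} (hm : 0 < m) :
    (Measure.pi fun _ : Fin m => π)
      {q | (fun i => (q i).2) ∉ sampleCorruptions ρ fun i => (q i).1} ≤
      ENNReal.ofReal (L / (δ ^ 2 * m)) := by
  have hu : Measurable (fun p : X × X => ρ p.1 p.2) := hρ.measurable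
  set c : X × X → ℝ := fun p => (ρ p.1 p.2).toReal with hc
  have hcm : Measurable c := hu.ennreal_toReal
  have hc0 (p) : 0 ≤ c p := ENNReal.toReal_nonneg
  have hcL : ∀ᵐ p ∂π, c p ∈ Set.Icc 0 L := hbd.mono fun p hp =>
    ⟨hc0 p, ENNReal.toReal_le_of_le_ofReal hL.le hp⟩
  have hcE : π[c] ≤ 1 - δ := by
    rw [integral_toReal hu.aemeasurable (hbd.mono fun p hp => hp.trans_lt ENNReal.ofReal_lt_top)]
    exact ENNReal.toReal_le_of_le_ofReal (by linarith) hmean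
  have hcE0 : 0 ≤ π[c] := integral_nonneg hc0
  have hcp : MemLp c 2 π := memLp_of_bounded hcL hcm.aestronglyMeasurable 2
  have hvar : variance c π ≤ L := by
    refine (variance_le_sub_mul_sub hcL hcm.aemeasurable).trans ?_
    nlinarith
  set P := Measure.pi fun _ : Fin m => π with hP
  set Y : (Fin m → X × X) → ℝ := ∑ i, fun q => c (q i) with hY
  have hYp : MemLp Y 2 P :=
    memLp_finsetSum' _ fun i _ => hcp.comp_measurePreserving (measurePreserving_eval _ i)
  have hYvar : variance Y P ≤ m * L := by
    rw [hY, variance_sum_pi (X := fun _ => c) fun _ => hcp]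
    simp only [Finset.sum_const, Finset.card_univ, Fintype.card_fin, nsmul_eq_mul]
    gcongr
  have hYE : P[Y] ≤ m * (1 - δ) := by
    have h1 (i : Fin m) : Integrable (fun q : Fin m → X × X => c (q i)) P :=
      (hcp.comp_measurePreserving (measurePreserving_eval (fun _ => π) i)).integrable (by norm_num)
    have h2 (i : Fin m) : ∫ q, c (q i) ∂P = π[c] := by
      rw [← (measurePreserving_eval (fun _ : Fin m => π) i).map_eq,
        integral_map (measurable_pi_apply i).aemeasurable hcm.aestronglyMeasurable]
    have : P[Y] = (m : ℝ) * π[c] := by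
      simp only [hY, Finset.sum_apply]
      rw [integral_finsetSum _ fun i _ => h1 i]
      simp [h2]
    rw [this]; gcongr
  have hm' : (0 : ℝ) < m := by exact_mod_cast hm
  have hcheb := meas_ge_le_variance_div_sq hYp (c := δ * m) (by positivity)
  have hfin : ∀ᵐ q ∂P, ∀ i, ρ (q i).1 (q i).2 ≤ ENNReal.ofReal L :=
    ae_all_iff.2 fun i =>
      (measurePreserving_eval (fun _ : Fin m => π) i).quasiMeasurePreserving.ae hbd
  have hsub : P {q | (fun i => (q i).2) ∉ sampleCorruptions ρ fun i => (q i).1} ≤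
      P {q | δ * m ≤ |Y q - P[Y]|} := by
    refine measure_mono_ae ?_
    filter_upwards [hfin] with q hq hill
    by_contra hlt
    apply hill
    change ¬ (δ * m ≤ |Y q - P[Y]|) at hlt
    rw [mem_sampleCorruptions_iff hm]
    have h1 := (abs_lt.1 (not_le.1 hlt)).2
    have h2 : Y q ≤ m := by nlinarith
    have h3 : ∑ i, ρ (q i).1 (q i).2 = ENNReal.ofReal (Y q) := by
      simp only [hY, Finset.sum_apply]
      rw [ENNReal.ofReal_sum_of_nonneg fun i _ => hc0 _]
      refine Finset.sum_congr rfl fun i _ => ?_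
      rw [ENNReal.ofReal_toReal ((hq i).trans_lt ENNReal.ofReal_lt_top).ne]
    rw [h3]
    calc ENNReal.ofReal (Y q) ≤ ENNReal.ofReal m := ENNReal.ofReal_le_ofReal h2
      _ = m := by simp
  refine (hsub.trans hcheb).trans (ENNReal.ofReal_le_ofReal ?_)
  calc variance Y P / (δ * m) ^ 2 ≤ m * L / (δ * m) ^ 2 := by gcongr
    _ = _ := by field_simp

variable [StandardBorelSpace X]

/-- A randomised strategy, given by a joint law of the input and the answer, does not beat the
pointwise supremum, even when the latter is integrated as a lower integral. -/
theorem lintegral_le_lintegral_iSup {A B : Type*} [MeasurableSpace A] [MeasurableSpace B]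
    [StandardBorelSpace B] [Nonempty B] (μ : Measure (A × B)) [IsFiniteMeasure μ]
    {g : A × B → ℝ≥0∞} (hg : Measurable g) :
    ∫⁻ q, g q ∂μ ≤ ∫⁻ a, ⨆ b, g (a, b) ∂(μ.map Prod.fst) := by
  rw [← Measure.lintegral_condKernel hg]
  refine lintegral_mono fun a => ?_
  calc ∫⁻ b, g (a, b) ∂(μ.condKernel a) ≤ ∫⁻ _, ⨆ b, g (a, b) ∂(μ.condKernel a) :=
        lintegral_mono fun b => le_iSup (fun b => g (a, b)) b
    _ = _ := by simp

/-- The adaptive adversary draws second coordinates from the modified coupling given the sample. The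
errors are the probability of an illegal draw, where `F ≤ 1` is used, and `n` times the change of
the second marginal. -/
theorem lintegral_le_adaptive (hρ : IsCostFunction ρ) {D D' : Measure X}
    [IsProbabilityMeasure D] (h : D' ∈ distCorruptions ρ D) {n m : ℕ} (hnm : n ≤ m) (hm : 0 < m)
    {f : (Fin n → X) → ℝ≥0∞} (hf : Measurable f) (hf1 : ∀ S, f S ≤ 1)
    {δ L : ℝ} (hδ : 0 < δ) (hδ1 : δ ≤ 1) (hL : 0 < L) :
    ∫⁻ S, f S ∂(Measure.pi fun _ => D') ≤
      ∫⁻ S, ⨆ S' ∈ sampleCorruptions ρ S, subsampleAverage m f S' ∂(Measure.pi fun _ => D) +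
        ENNReal.ofReal (L / (δ ^ 2 * m)) + n * ENNReal.ofReal (δ + 1 / L) := by
  have hD' := isProbabilityMeasure_of_mem_distCorruptions h
  obtain ⟨π, hπ, hbd, hmean, htv⟩ := exists_bounded_coupling hρ h hδ hδ1 hL
  have hπp := isProbabilityMeasure_of_map (π := π) measurable_fst (h := by rw [hπ]; assumption)
  have : IsProbabilityMeasure (π.map Prod.snd) :=
    Measure.isProbabilityMeasure_map measurable_snd.aemeasurable
  have : IsProbabilityMeasure (π.map Prod.fst) :=
    Measure.isProbabilityMeasure_map measurable_fst.aemeasurable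
  have : Nonempty X := nonempty_of_isProbabilityMeasure D
  set F := subsampleAverage m f with hF
  have hFm : Measurable F := measurable_subsampleAverage hf
  have hF1 (S) : F S ≤ 1 := subsampleAverage_le_one hf1 S
  set P := Measure.pi fun _ : Fin m => π with hP
  set ψ : (Fin m → X × X) → (Fin m → X) × (Fin m → X) :=
    fun q => (fun i => (q i).1, fun i => (q i).2) with hψ
  have hψm : Measurable ψ := by fun_prop
  set E : Set ((Fin m → X) × (Fin m → X)) := {q | q.2 ∈ sampleCorruptions ρ q.1} with hE
  have hEm : MeasurableSet E := measurableSet_legal hρ m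
  have hG : Measurable (E.indicator fun q : (Fin m → X) × (Fin m → X) => F q.2) :=
    (hFm.comp measurable_snd).indicator hEm
  have hsndP : P.map (fun q i => (q i).2) = Measure.pi fun _ : Fin m => π.map Prod.snd :=
    Measure.pi_map_pi fun _ => measurable_snd.aemeasurable
  have hfstP : P.map (fun q i => (q i).1) = Measure.pi fun _ : Fin m => D := by
    rw [← hπ]; exact Measure.pi_map_pi fun _ => measurable_fst.aemeasurable
  calc ∫⁻ S, f S ∂(Measure.pi fun _ => D')
      ≤ ∫⁻ S, f S ∂(Measure.pi fun _ => π.map Prod.snd) + n * ENNReal.ofReal (δ + 1 / L) := by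
        refine lintegral_pi_le_add (fun g hg hg1 => ?_) hf hf1
        rw [lintegral_map hg measurable_snd]
        exact htv g hg hg1
    _ = ∫⁻ q, F (ψ q).2 ∂P + n * ENNReal.ofReal (δ + 1 / L) := by
        rw [← lintegral_pi_subsampleAverage hnm hf, ← hsndP, lintegral_map hFm (by fun_prop)]
    _ ≤ ∫⁻ q, E.indicator (fun q => F q.2) (ψ q) ∂P + P (ψ ⁻¹' Eᶜ) +
          n * ENNReal.ofReal (δ + 1 / L) := by
        gcongr
        rw [← lintegral_indicator_one (hψm hEm.compl), ← lintegral_add_left (by exact hG.comp hψm)]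
        refine lintegral_mono fun q => ?_
        by_cases hq : ψ q ∈ E
        · simp [hq]
        · have : q ∈ ψ ⁻¹' Eᶜ := hq
          simp only [Set.indicator_of_mem this, Pi.one_apply]
          exact (hF1 _).trans le_add_self
    _ ≤ _ := by
        gcongr
        · rw [← lintegral_map hG hψm]
          refine (lintegral_le_lintegral_iSup _ hG).trans ?_
          rw [Measure.map_map measurable_fst hψm]
          change ∫⁻ a, _ ∂(P.map fun q i => (q i).1) ≤ _
          rw [hfstP]
          refine lintegral_mono fun S => iSup_le fun S' => ?_
          by_cases hq : S' ∈ sampleCorruptions ρ S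
          · rw [Set.indicator_of_mem (by exact hq)]
            exact le_iSup₂ (f := fun S' (_ : S' ∈ sampleCorruptions ρ S) => F S') S' hq
          · rw [Set.indicator_of_notMem (by exact hq)]; exact zero_le
        · exact measure_illegal_le hρ hδ hL hδ1 hbd hmean hm

end ObliviousLeAdaptive

/-! ### Lusin–Novikov uniformization for sections of bounded size -/

section Enumeration

variable {X : Type*} [MeasurableSpace X] [StandardBorelSpace X]

/-- A Borel relation with at most `k` points in each section is covered by the graphs of `k`
Borel functions. -/
theorem exists_measurable_graph_cover [Nonempty X] (k : ℕ) :
    ∀ R : Set (X × X), MeasurableSet R → (∀ x, {y | (x, y) ∈ R}.encard ≤ k) →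
      ∃ g : Fin k → X → X, (∀ j, Measurable (g j)) ∧ ∀ x y, (x, y) ∈ R → ∃ j, y = g j x := by
  induction k with
  | zero =>
    intro R _ hR
    refine ⟨fun j => j.elim0, fun j => j.elim0, fun x y hxy => ?_⟩
    have := hR x
    simp only [Nat.cast_zero, nonpos_iff_eq_zero, Set.encard_eq_zero] at this
    exact absurd hxy (Set.eq_empty_iff_forall_notMem.1 this y)
  | succ k ih =>
    intro R hRm hR
    obtain ⟨i, hi⟩ := exists_measurableEmbedding_real X
    -- Listing a full section of `k + 1` points in increasing order, with respect to a Borel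
    -- embedding into the reals, makes the list unique. Thus `E` projects injectively to `X`; by
    -- Lusin–Souslin its image `T` is Borel and the list is a Borel function of the point of `T`.
    set E : Set (X × (Fin (k + 1) → X)) :=
      {q | (∀ j, (q.1, q.2 j) ∈ R) ∧ ∀ a b, a < b → i (q.2 a) < i (q.2 b)} with hE
    have hEm : MeasurableSet E := by
      have h1 : MeasurableSet {q : X × (Fin (k + 1) → X) | ∀ j, (q.1, q.2 j) ∈ R} := by
        rw [Set.ofPred_forall]
        exact MeasurableSet.iInter fun j => hRm.preimage (f := fun q : X × (Fin (k + 1) → X) =>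
          (q.1, q.2 j)) (by fun_prop)
      have h2 : MeasurableSet {q : X × (Fin (k + 1) → X) |
          ∀ a b, a < b → i (q.2 a) < i (q.2 b)} := by
        simp only [Set.ofPred_forall]
        refine MeasurableSet.iInter fun a => MeasurableSet.iInter fun b =>
          MeasurableSet.iInter fun _ => ?_
        have := hi.measurable
        exact measurableSet_lt (by fun_prop) (by fun_prop)
      exact h1.inter h2
    have hsec {x : X} {y : Fin (k + 1) → X} (hq : (x, y) ∈ E) : Set.range y = {z | (x, z) ∈ R} := by
      have hinj : Function.Injective y := by
        have : StrictMono fun a => i (y a) := fun a b hab => hq.2 a b hab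
        exact fun a b hab => this.injective (congrArg i hab)
      refine Set.Finite.eq_of_subset_of_encard_le
        (Set.finite_range y) (fun z ⟨j, hj⟩ => hj ▸ hq.1 j) ?_
      rw [← Set.image_univ, hinj.encard_image, Set.encard_univ]
      simpa using hR x
    have hinj : Function.Injective fun q : E => q.1.1 := by
      rintro ⟨⟨x, y⟩, hy⟩ ⟨⟨x', y'⟩, hy'⟩ hxx
      simp only at hxx
      subst hxx
      have hr : Set.range (fun a => i (y a)) = Set.range fun a => i (y' a) := by
        rw [Set.range_comp' i, Set.range_comp' i y', hsec hy, hsec hy']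
      have hm : StrictMono fun a => i (y a) := fun a b hab => hy.2 a b hab
      have hm' : StrictMono fun a => i (y' a) := fun a b hab => hy'.2 a b hab
      have := (StrictMono.range_inj hm hm').1 hr
      have : y = y' := funext fun a => hi.injective (congrFun this a)
      subst this; rfl
    have : StandardBorelSpace E := hEm.standardBorel
    have hemb : MeasurableEmbedding fun q : E => q.1.1 :=
      (by fun_prop : Measurable fun q : E => q.1.1).measurableEmbedding hinj
    obtain ⟨y, hym, hy⟩ := hemb.exists_measurable_extend
      (g := fun q : E => q.1.2) (by fun_prop) fun _ => inferInstance
    set T : Set X := Set.range fun q : E => q.1.1 with hT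
    have hTm : MeasurableSet T := hemb.measurableSet_range
    -- Off `T` the sections have at most `k` points, since a section with `k + 1` points can be
    -- sorted into an element of `E`.
    obtain ⟨g, hg, hgc⟩ := ih (R ∩ Prod.fst ⁻¹' Tᶜ) (hRm.inter (measurable_fst hTm.compl)) (by
      intro x
      by_cases hx : x ∈ T
      · simp [hx]
      · have hle : {z | (x, z) ∈ R ∩ Prod.fst ⁻¹' Tᶜ}.encard ≤ (k + 1 : ℕ) :=
          (Set.encard_le_encard fun z hz => hz.1).trans (hR x)
        by_contra hlt
        apply hx
        have hfin : {z | (x, z) ∈ R}.Finite := Set.finite_of_encard_le_coe (hR x)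
        have hle' : {z | (x, z) ∈ R ∩ Prod.fst ⁻¹' Tᶜ}.encard ≤ {z | (x, z) ∈ R}.encard :=
          Set.encard_le_encard fun z hz => hz.1
        have hcard : ((hfin.image i).toFinset).card = k + 1 := by
          have h0 : (i '' {z | (x, z) ∈ R}).encard = ((hfin.image i).toFinset).card := by
            rw [← Set.encard_coe_eq_coe_finsetCard, Set.Finite.coe_toFinset]
          rw [hi.injective.encard_image] at h0
          have h1 := hR x
          rw [h0] at h1 hle'
          have h2 : ((k : ℕ) : ℕ∞) < ((hfin.image i).toFinset).card :=
            (not_le.1 hlt).trans_le hle'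
          have h1' : ((hfin.image i).toFinset).card ≤ k + 1 := by exact_mod_cast h1
          have h2' : k < ((hfin.image i).toFinset).card := by exact_mod_cast h2
          omega
        set s := (hfin.image i).toFinset with hs
        have hmem (a) : s.orderEmbOfFin hcard a ∈ i '' {z | (x, z) ∈ R} := by
          have := s.orderEmbOfFin_mem hcard a
          exact (Set.Finite.mem_toFinset _).1 this
        choose z hz hzi using hmem
        refine ⟨⟨(x, z), fun j => hz j, fun a b hab => ?_⟩, rfl⟩
        change i (z a) < i (z b)
        rw [hzi, hzi]
        exact (s.orderEmbOfFin hcard).strictMono hab)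
    classical
    refine ⟨fun j x => if x ∈ T then y x j else
      (if h : j.1 < k then g ⟨j, h⟩ x else Classical.arbitrary X), fun j => ?_, fun x z hxz => ?_⟩
    · refine Measurable.ite hTm (by fun_prop) ?_
      by_cases h : j.1 < k
      · simpa [h] using hg _
      · simp [h]
    · by_cases hx : x ∈ T
      · obtain ⟨⟨⟨x', w⟩, hw⟩, rfl⟩ := hx
        have h1 : y x' = w := congrFun hy ⟨⟨x', w⟩, hw⟩
        have h2 : z ∈ Set.range w := by rw [hsec hw]; exact hxz
        obtain ⟨j, rfl⟩ := h2
        refine ⟨j, ?_⟩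
        have : x' ∈ T := ⟨⟨⟨x', w⟩, hw⟩, rfl⟩
        simp [this, h1]
      · obtain ⟨j, hj⟩ := hgc x z ⟨hxz, hx⟩
        exact ⟨j.castSucc, by simpa [hx] using hj⟩

end Enumeration

/-! ### Marginal densities over sets of point and label components -/

section Marginals

variable {ι X Y : Type*}

/-- The configuration that agrees with `ω` on the first components indexed by `a.1` and the second
components indexed by `a.2`, and with `ω'` elsewhere. -/
def splice [DecidableEq ι] (a : Finset ι × Finset ι) (ω ω' : ι → X × Y) : ι → X × Y := fun i =>
  (if i ∈ a.1 then (ω i).1 else (ω' i).1, if i ∈ a.2 then (ω i).2 else (ω' i).2)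

section Splice

variable [DecidableEq ι]

theorem splice_splice (a b : Finset ι × Finset ι) (ω ω' ω'' : ι → X × Y) :
    splice a (splice b ω ω') ω'' = splice (a ⊓ b) ω (splice a ω' ω'') := by
  funext i
  simp only [splice, Prod.fst_inf, Prod.snd_inf, Finset.inf_eq_inter, Finset.mem_inter]
  ext <;> simp only <;> split_ifs <;> simp_all

theorem splice_splice_of_le {a b : Finset ι × Finset ι} (h : a ≤ b) (ω ω' ω'' : ι → X × Y) :
    splice a (splice b ω ω') ω'' = splice a ω ω'' := by
  rw [splice_splice, inf_eq_left.2 h]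
  funext i
  simp only [splice]
  ext <;> simp only <;> split_ifs <;> simp_all

theorem splice_comp_perm (a : Finset ι × Finset ι) (σ : Equiv.Perm ι) (ω ω' : ι → X × Y) :
    splice a ω ω' ∘ σ =
      splice (a.1.map σ.symm.toEmbedding, a.2.map σ.symm.toEmbedding) (ω ∘ σ) (ω' ∘ σ) := by
  funext i
  simp [splice, Finset.mem_map_equiv]

end Splice

variable [Fintype ι] [DecidableEq ι] [MeasurableSpace X] [MeasurableSpace Y]

theorem measurable_splice (a : Finset ι × Finset ι) :
    Measurable fun p : (ι → X × Y) × (ι → X × Y) => splice a p.1 p.2 := by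
  refine measurable_pi_lambda _ fun i => ?_
  simp only [splice]
  refine Measurable.prodMk ?_ ?_ <;> split_ifs <;> fun_prop

/-- The i.i.d. configurations with independent components `D` and `U`. -/
noncomputable abbrev iid (ι : Type*) [Fintype ι] (D : Measure X) (U : Measure Y) :
    Measure (ι → X × Y) :=
  Measure.pi fun _ => D.prod U

variable (D : Measure X) (U : Measure Y) [IsProbabilityMeasure D] [IsProbabilityMeasure U]

/-- Every scalar component is taken from one of two independent copies, and all components are
independent under `iid`. Points and labels need separate index sets because the entropy argument
reveals them separately. -/
theorem measurePreserving_splice (a : Finset ι × Finset ι) :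
    MeasurePreserving (fun p : (ι → X × Y) × (ι → X × Y) => splice a p.1 p.2)
      ((iid ι D U).prod (iid ι D U)) (iid ι D U) := by
  set ν := D.prod U
  have h1 : MeasurePreserving (fun q : ι → (X × Y) × (X × Y) =>
      (fun i => (q i).1, fun i => (q i).2))
      (Measure.pi fun _ => ν.prod ν) ((iid ι D U).prod (iid ι D U)) :=
    measurePreserving_arrowProdEquivProdArrow (X × Y) (X × Y) ι (fun _ => ν) fun _ => ν
  have hc (u v : Prop) [Decidable u] [Decidable v] :
      MeasurePreserving (fun z : (X × Y) × (X × Y) =>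
        (if u then z.1.1 else z.2.1, if v then z.1.2 else z.2.2)) (ν.prod ν) ν := by
    by_cases hu : u <;> by_cases hv : v <;> simp only [hu, hv, if_true, if_false]
    · exact measurePreserving_fst
    · exact (measurePreserving_fst (μ := D) (ν := U)).prod
        (measurePreserving_snd (μ := D) (ν := U))
    · have h : MeasurePreserving (fun z : (X × Y) × (X × Y) => (z.1.1, z.2.2)) (ν.prod ν) ν :=
        (measurePreserving_fst (μ := D) (ν := U)).prod (measurePreserving_snd (μ := D) (ν := U))
      exact h.comp (Measure.measurePreserving_swap (μ := ν) (ν := ν))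
    · exact measurePreserving_snd
  have h2 : MeasurePreserving (fun (q : ι → (X × Y) × (X × Y)) (i : ι) =>
      (if i ∈ a.1 then (q i).1.1 else (q i).2.1, if i ∈ a.2 then (q i).1.2 else (q i).2.2))
      (Measure.pi fun _ => ν.prod ν) (iid ι D U) :=
    measurePreserving_pi (f := fun i (z : (X × Y) × (X × Y)) =>
      (if i ∈ a.1 then z.1.1 else z.2.1, if i ∈ a.2 then z.1.2 else z.2.2))
      (fun _ => ν.prod ν) (fun _ => ν) fun i => hc _ _
  refine ⟨measurable_splice a, ?_⟩
  rw [← h1.map_eq, Measure.map_map (measurable_splice a) h1.measurable]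
  exact h2.map_eq

/-- The function `q` with all components outside `a` integrated out. -/
noncomputable def marginal (a : Finset ι × Finset ι) (q : (ι → X × Y) → ℝ≥0∞)
    (ω : ι → X × Y) : ℝ≥0∞ :=
  ∫⁻ ω', q (splice a ω ω') ∂(iid ι D U)

variable {D U} {a b : Finset ι × Finset ι} {q g : (ι → X × Y) → ℝ≥0∞}

theorem measurable_marginal (hq : Measurable q) : Measurable (marginal D U a q) :=
  (hq.comp (measurable_splice a)).lintegral_prod_right'

theorem measurable_splice_right (ω : ι → X × Y) :
    Measurable fun ω' : ι → X × Y => splice a ω ω' :=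
  (measurable_splice a).comp measurable_prodMk_left

theorem marginal_splice (h : a ≤ b) (ω ω' : ι → X × Y) :
    marginal D U a q (splice b ω ω') = marginal D U a q ω := by
  simp only [marginal, splice_splice_of_le h]

theorem lintegral_splice (hq : Measurable q) :
    ∫⁻ ω, ∫⁻ ω', q (splice a ω ω') ∂(iid ι D U) ∂(iid ι D U) = ∫⁻ ω, q ω ∂(iid ι D U) := by
  have hm : Measurable fun p : (ι → X × Y) × (ι → X × Y) => q (splice a p.1 p.2) :=
    hq.comp (measurable_splice a)
  rw [← (measurePreserving_splice D U a).lintegral_comp hq, lintegral_prod _ hm.aemeasurable]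

theorem lintegral_marginal (hq : Measurable q) :
    ∫⁻ ω, marginal D U a q ω ∂(iid ι D U) = ∫⁻ ω, q ω ∂(iid ι D U) :=
  lintegral_splice hq

/-- The reference measure is a product, so integrating out two sets of components successively
integrates out their union. This is the property behind supermodularity of entropy. -/
theorem marginal_marginal (hq : Measurable q) (ω : ι → X × Y) :
    marginal D U a (marginal D U b q) ω = marginal D U (a ⊓ b) q ω := by
  simp only [marginal, splice_splice]
  rw [inf_comm b a]
  exact lintegral_splice (q := fun ω' => q (splice (a ⊓ b) ω ω'))
    (hq.comp (measurable_splice_right ω))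

theorem marginal_mul (hq : Measurable q) (hg : ∀ ω ω', g (splice a ω ω') = g ω)
    (ω : ι → X × Y) :
    marginal D U a (fun ω => g ω * q ω) ω = g ω * marginal D U a q ω := by
  simp only [marginal, hg]
  exact lintegral_const_mul _ (hq.comp (measurable_splice_right ω))

theorem lintegral_mul_marginal (hq : Measurable q) (hgm : Measurable g)
    (hg : ∀ ω ω', g (splice a ω ω') = g ω) :
    ∫⁻ ω, g ω * marginal D U a q ω ∂(iid ι D U) = ∫⁻ ω, g ω * q ω ∂(iid ι D U) := by
  have hm : Measurable fun ω => g ω * q ω := hgm.mul hq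
  rw [← lintegral_marginal (a := a) hm]
  exact lintegral_congr fun ω => (marginal_mul hq hg ω).symm

theorem marginal_bot (ω : ι → X × Y) :
    marginal D U ⊥ q ω = ∫⁻ ω, q ω ∂(iid ι D U) := by
  have h (ω' : ι → X × Y) : splice (⊥ : Finset ι × Finset ι) ω ω' = ω' := by
    funext i; simp [splice]
  simp [marginal, h]

theorem marginal_le {K : ℝ≥0∞} (h : ∀ ω, q ω ≤ K) (ω : ι → X × Y) :
    marginal D U a q ω ≤ K := by
  calc marginal D U a q ω ≤ ∫⁻ _, K ∂(iid ι D U) := lintegral_mono fun _ => h _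
    _ = K := by simp

theorem measurePreserving_comp_perm (σ : Equiv.Perm ι) :
    MeasurePreserving (fun ω : ι → X × Y => ω ∘ σ) (iid ι D U) (iid ι D U) :=
  measurePreserving_pi_comp_injective (D.prod U) σ.injective

/-- The image of a pair of index sets under a permutation. -/
def mapPair (σ : Equiv.Perm ι) (a : Finset ι × Finset ι) : Finset ι × Finset ι :=
  (a.1.map σ.toEmbedding, a.2.map σ.toEmbedding)

theorem marginal_mapPair (hq : Measurable q) (σ : Equiv.Perm ι) (ω : ι → X × Y) :
    marginal D U (mapPair σ a) q ω = marginal D U a (fun ω => q (ω ∘ σ.symm)) (ω ∘ σ) := by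
  have h (ω') : splice a (ω ∘ σ) (ω' ∘ σ) ∘ σ.symm = splice (mapPair σ a) ω ω' := by
    rw [splice_comp_perm]
    have e (τ : ι → X × Y) : (τ ∘ σ) ∘ σ.symm = τ := by funext i; simp
    simp [e, mapPair]
  have hm : Measurable fun ω' => q (splice a (ω ∘ σ) ω' ∘ σ.symm) :=
    hq.comp ((measurable_comp_index _).comp (measurable_splice_right _))
  rw [marginal, marginal, ← (measurePreserving_comp_perm (D := D) (U := U) σ).lintegral_comp hm]
  simp only [h]

/-- Revealing one more atomic component multiplies the marginal density by at most the inverse of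
the smallest mass of an atom. -/
theorem mul_marginal_le [MeasurableSingletonClass Y] (hq : Measurable q) {c : ℝ≥0∞}
    (hc : ∀ y, c ≤ U {y}) (i : ι) (ω : ι → X × Y) :
    c * marginal D U (a ⊔ (∅, {i})) q ω ≤ marginal D U a q ω := by
  have hle : a ⊓ (a ⊔ (∅, {i})) = a := inf_sup_self
  set S : Set (ι → X × Y) := {ω' | (ω' i).2 = (ω i).2} with hS
  have hSm : MeasurableSet S :=
    (measurableSet_singleton (ω i).2).preimage
      (f := fun ω' : ι → X × Y => (ω' i).2) (by fun_prop)
  have hmass : c ≤ iid ι D U S := by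
    have h := (measurePreserving_snd (μ := D) (ν := U)).comp
      (measurePreserving_eval (fun _ : ι => D.prod U) i)
    have h2 := h.measure_preimage (measurableSet_singleton (ω i).2).nullMeasurableSet
    exact (hc _).trans h2.ge
  -- With probability at least `c` the redrawn label at `i` equals the given one; on that event,
  -- revealing it changes nothing.
  calc c * marginal D U (a ⊔ (∅, {i})) q ω
      ≤ iid ι D U S * marginal D U (a ⊔ (∅, {i})) q ω := by gcongr
    _ = ∫⁻ ω', S.indicator (fun _ => marginal D U (a ⊔ (∅, {i})) q ω) ω' ∂(iid ι D U) := by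
        rw [lintegral_indicator_const hSm, mul_comm]
    _ ≤ ∫⁻ ω', marginal D U (a ⊔ (∅, {i})) q (splice a ω ω') ∂(iid ι D U) := by
        refine lintegral_mono (Set.indicator_le fun ω' hω' => ?_)
        have : splice a ω ω' = splice (a ⊔ (∅, {i})) ω ω' := by
          funext j
          ext
          · simp [splice]
          · by_cases hj : j = i
            · subst hj
              have : (ω' j).2 = (ω j).2 := hω'
              simp [splice, this]
            · simp [splice, hj]
        rw [this, marginal_splice le_rfl]
    _ = marginal D U a q ω := by
        have h := marginal_marginal (D := D) (U := U) (a := a) (b := a ⊔ (∅, {i})) hq ω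
        rw [hle] at h
        exact h

end Marginals

/-! ### Relative entropy of an exchangeable law -/

section Entropy

variable {ι X Y : Type*} [Fintype ι] [DecidableEq ι] [MeasurableSpace X] [MeasurableSpace Y]

/-- An exchangeable bounded density with respect to `iid ι D U` under which the first components
remain i.i.d. with law `D`. -/
structure IsExchangeableDensity (D : Measure X) (U : Measure Y) (q : (ι → X × Y) → ℝ≥0∞) :
    Prop where
  measurable : Measurable q
  bounded : ∃ K : ℝ≥0∞, K ≠ ∞ ∧ ∀ ω, q ω ≤ K
  comp_perm : ∀ (σ : Equiv.Perm ι) ω, q (ω ∘ σ) = q ω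
  marginal_fst : ∀ ω, marginal D U (Finset.univ, ∅) q ω = 1

/-- The law with density `q`. -/
noncomputable def law (D : Measure X) (U : Measure Y) (q : (ι → X × Y) → ℝ≥0∞) :
    Measure (ι → X × Y) :=
  (iid ι D U).withDensity q

/-- The relative entropy, with respect to `iid ι D U`, of the components indexed by `a`. -/
noncomputable def entropy (D : Measure X) (U : Measure Y) (q : (ι → X × Y) → ℝ≥0∞)
    (a : Finset ι × Finset ι) : ℝ :=
  ∫ ω, Real.log (marginal D U a q ω).toReal ∂(law D U q)

variable {D : Measure X} {U : Measure Y} [IsProbabilityMeasure D] [IsProbabilityMeasure U]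
  {q g : (ι → X × Y) → ℝ≥0∞} {a b : Finset ι × Finset ι}

namespace IsExchangeableDensity

theorem lintegral_eq_one (hq : IsExchangeableDensity D U q) : ∫⁻ ω, q ω ∂(iid ι D U) = 1 := by
  rw [← lintegral_marginal (a := (Finset.univ, ∅)) hq.measurable]
  simp [hq.marginal_fst]

theorem isProbabilityMeasure_law (hq : IsExchangeableDensity D U q) :
    IsProbabilityMeasure (law D U q) := by
  refine ⟨?_⟩
  rw [law, withDensity_apply _ MeasurableSet.univ, Measure.restrict_univ, hq.lintegral_eq_one]

theorem marginal_ne_top (hq : IsExchangeableDensity D U q) (ω : ι → X × Y) :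
    marginal D U a q ω ≠ ∞ := by
  obtain ⟨K, hK, h⟩ := hq.bounded
  exact ne_top_of_le_ne_top hK (marginal_le h ω)

theorem lintegral_law (hq : IsExchangeableDensity D U q) (hg : Measurable g) :
    ∫⁻ ω, g ω ∂(law D U q) = ∫⁻ ω, g ω * q ω ∂(iid ι D U) := by
  rw [law, lintegral_withDensity_eq_lintegral_mul _ hq.measurable hg]
  simp only [Pi.mul_apply, mul_comm]

theorem lintegral_law_of_dep (hq : IsExchangeableDensity D U q) (hg : Measurable g)
    (h : ∀ ω ω', g (splice a ω ω') = g ω) :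
    ∫⁻ ω, g ω ∂(law D U q) = ∫⁻ ω, g ω * marginal D U a q ω ∂(iid ι D U) := by
  rw [hq.lintegral_law hg, lintegral_mul_marginal hq.measurable hg h]

/-- Membership in the zero set of a marginal density depends only on the components in `a`, so its
mass is the integral of that density over its own zero set. -/
theorem ae_marginal_ne_zero (hq : IsExchangeableDensity D U q) :
    ∀ᵐ ω ∂(law D U q), marginal D U a q ω ≠ 0 := by
  have hm : Measurable (marginal D U a q) := measurable_marginal hq.measurable
  set S : Set (ι → X × Y) := {ω | marginal D U a q ω = 0} with hS
  have hSm : MeasurableSet S := hm (measurableSet_singleton 0)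
  rw [ae_iff]
  simp only [not_not]
  change law D U q S = 0
  rw [← lintegral_indicator_one hSm, hq.lintegral_law_of_dep (a := a)
    (measurable_one.indicator hSm)]
  · rw [← lintegral_zero (μ := iid ι D U)]
    refine lintegral_congr fun ω => ?_
    by_cases h : ω ∈ S
    · rw [show marginal D U a q ω = 0 from h, mul_zero]
    · simp [h]
  · intro ω ω'
    have : splice a ω ω' ∈ S ↔ ω ∈ S := by
      simp only [hS, Set.mem_ofPred_eq, marginal_splice le_rfl]
    by_cases h : ω ∈ S
    · simp [h, this.2 h]
    · simp [h, mt this.1 h]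

theorem measurable_log_marginal (hq : IsExchangeableDensity D U q) :
    Measurable fun ω => Real.log (marginal D U a q ω).toReal :=
  (measurable_marginal hq.measurable).ennreal_toReal.log

/-- Under the law, `|log p|` is integrated against `p`, and `p log p` is bounded because `p` takes
values in a bounded interval. -/
theorem integrable_log (hq : IsExchangeableDensity D U q) :
    Integrable (fun ω => Real.log (marginal D U a q ω).toReal) (law D U q) := by
  obtain ⟨K, hK, hqK⟩ := hq.bounded
  have hm := hq.measurable_log_marginal (a := a)
  refine ⟨hm.aestronglyMeasurable, ?_⟩
  rw [HasFiniteIntegral, hq.lintegral_law_of_dep (a := a) hm.enorm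
    fun ω ω' => by rw [marginal_splice le_rfl]]
  obtain ⟨B, hB⟩ := (isCompact_Icc (a := (0 : ℝ)) (b := K.toReal)).exists_bound_of_continuousOn
    Real.continuous_mul_log.continuousOn
  refine lt_of_le_of_lt (lintegral_mono (g := fun _ => ENNReal.ofReal B) fun ω => ?_) (by simp)
  have hfin := hq.marginal_ne_top (a := a) ω
  have h1 := hB (marginal D U a q ω).toReal ⟨ENNReal.toReal_nonneg,
    ENNReal.toReal_mono hK (marginal_le hqK ω)⟩
  rw [← ENNReal.ofReal_toReal hfin, ← ofReal_norm, ← ENNReal.ofReal_mul (norm_nonneg _)]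
  refine ENNReal.ofReal_le_ofReal ?_
  rw [ENNReal.toReal_ofReal ENNReal.toReal_nonneg]
  rw [norm_mul, Real.norm_of_nonneg ENNReal.toReal_nonneg] at h1
  linarith

theorem entropy_nonneg (hq : IsExchangeableDensity D U q) (a : Finset ι × Finset ι) :
    0 ≤ entropy D U q a := by
  have := hq.isProbabilityMeasure_law
  have hm : Measurable (marginal D U a q) := measurable_marginal hq.measurable
  have hlog (ω : ι → X × Y) : Real.log ((marginal D U a q ω)⁻¹).toReal =
      -Real.log (marginal D U a q ω).toReal := by
    rw [ENNReal.toReal_inv, Real.log_inv]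
  have h := integral_log_nonpos (μ := law D U q) (r := fun ω => (marginal D U a q ω)⁻¹)
    hm.inv ?_ ?_ ?_
  · simp only [hlog, integral_neg] at h
    unfold entropy; linarith
  · rw [hq.lintegral_law_of_dep (a := a) (g := fun ω => (marginal D U a q ω)⁻¹) hm.inv
      fun ω ω' => by rw [marginal_splice le_rfl]]
    calc _ ≤ ∫⁻ _, 1 ∂(iid ι D U) := lintegral_mono fun ω => ENNReal.inv_mul_le_one _
      _ = 1 := by simp
  · exact Filter.Eventually.of_forall fun ω => ENNReal.inv_ne_zero.2 (hq.marginal_ne_top ω)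
  · simp only [hlog]; exact hq.integrable_log.neg

/-- This is nonnegativity of conditional mutual information. The ratio `r` compares the density that
makes `a` and `b` conditionally independent given `a ⊓ b` with the true density on `a ⊔ b`; its
integral is at most `1`, so Gibbs' inequality applies. -/
theorem entropy_supermodular (hq : IsExchangeableDensity D U q) (a b : Finset ι × Finset ι) :
    entropy D U q a + entropy D U q b ≤ entropy D U q (a ⊔ b) + entropy D U q (a ⊓ b) := by
  have := hq.isProbabilityMeasure_law
  have hm (c : Finset ι × Finset ι) : Measurable (marginal D U c q) :=
    measurable_marginal hq.measurable
  set r : (ι → X × Y) → ℝ≥0∞ := fun ω => marginal D U a q ω *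
    ((marginal D U (a ⊓ b) q ω)⁻¹ * marginal D U b q ω) * (marginal D U (a ⊔ b) q ω)⁻¹ with hr
  have hrm : Measurable r :=
    ((hm a).mul ((hm (a ⊓ b)).inv.mul (hm b))).mul (hm (a ⊔ b)).inv
  have hlog : (fun ω => Real.log (r ω).toReal) =ᵐ[law D U q] fun ω =>
      Real.log (marginal D U a q ω).toReal + Real.log (marginal D U b q ω).toReal -
        Real.log (marginal D U (a ⊓ b) q ω).toReal -
        Real.log (marginal D U (a ⊔ b) q ω).toReal := by
    filter_upwards [hq.ae_marginal_ne_zero (a := a), hq.ae_marginal_ne_zero (a := b),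
      hq.ae_marginal_ne_zero (a := a ⊓ b), hq.ae_marginal_ne_zero (a := a ⊔ b)] with ω h1 h2 h3 h4
    have p {c} (h : marginal D U c q ω ≠ 0) : (marginal D U c q ω).toReal ≠ 0 :=
      (ENNReal.toReal_pos h (hq.marginal_ne_top ω)).ne'
    simp only [hr, ENNReal.toReal_mul, ENNReal.toReal_inv]
    rw [Real.log_mul (mul_ne_zero (p h1) (mul_ne_zero (inv_ne_zero (p h3)) (p h2)))
        (inv_ne_zero (p h4)), Real.log_mul (p h1) (mul_ne_zero (inv_ne_zero (p h3)) (p h2)),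
      Real.log_mul (inv_ne_zero (p h3)) (p h2), Real.log_inv, Real.log_inv]
    ring
  have hi (c : Finset ι × Finset ι) := hq.integrable_log (a := c)
  have h := integral_log_nonpos (μ := law D U q) hrm ?_ ?_ ?_
  · rw [integral_congr_ae hlog, integral_sub (by exact ((hi a).add (hi b)).sub (hi _)) (hi _),
      integral_sub (by exact (hi a).add (hi b)) (hi _), integral_add (hi a) (hi b)] at h
    unfold entropy; linarith
  · have hdep (ω ω') : r (splice (a ⊔ b) ω ω') = r ω := by
      simp only [hr, marginal_splice le_rfl, marginal_splice (le_sup_left : a ≤ a ⊔ b),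
        marginal_splice (le_sup_right : b ≤ a ⊔ b),
        marginal_splice (inf_le_left.trans le_sup_left : a ⊓ b ≤ a ⊔ b)]
    rw [hq.lintegral_law_of_dep (a := a ⊔ b) hrm hdep]
    -- Integrating out what lies outside `a` turns the marginal on `b` into that on `a ⊓ b`, which
    -- cancels. Some steps are inequalities because a marginal may vanish.
    calc ∫⁻ ω, r ω * marginal D U (a ⊔ b) q ω ∂(iid ι D U)
        ≤ ∫⁻ ω, marginal D U a q ω *
            ((marginal D U (a ⊓ b) q ω)⁻¹ * marginal D U b q ω) ∂(iid ι D U) := by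
          refine lintegral_mono fun ω => ?_
          simp only [hr]
          rw [mul_assoc]
          exact mul_le_of_le_one_right' (ENNReal.inv_mul_le_one _)
      _ = ∫⁻ ω, marginal D U a q ω * marginal D U a (fun ω =>
            (marginal D U (a ⊓ b) q ω)⁻¹ * marginal D U b q ω) ω ∂(iid ι D U) :=
          (lintegral_mul_marginal ((hm _).inv.mul (hm b)) (hm a)
            fun ω ω' => marginal_splice le_rfl _ _).symm
      _ ≤ ∫⁻ ω, marginal D U a q ω ∂(iid ι D U) := by
          refine lintegral_mono fun ω => mul_le_of_le_one_right' ?_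
          rw [marginal_mul (hm b) (fun ω ω' => by rw [marginal_splice inf_le_left]),
            marginal_marginal hq.measurable]
          exact ENNReal.inv_mul_le_one _
      _ = 1 := by rw [lintegral_marginal hq.measurable, hq.lintegral_eq_one]
  · filter_upwards [hq.ae_marginal_ne_zero (a := a), hq.ae_marginal_ne_zero (a := b)] with ω h1 h2
    exact mul_ne_zero (mul_ne_zero h1 (mul_ne_zero
      (ENNReal.inv_ne_zero.2 (hq.marginal_ne_top ω)) h2))
      (ENNReal.inv_ne_zero.2 (hq.marginal_ne_top ω))
  · rw [integrable_congr hlog]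
    exact (((hi a).add (hi b)).sub (hi _)).sub (hi _)

/-- The density grows pointwise by at most the factor `c` (`mul_marginal_le`). Here `c` will be the
number of labels. -/
theorem entropy_sup_label_le [MeasurableSingletonClass Y] (hq : IsExchangeableDensity D U q)
    {c : ℝ} (hc0 : 0 < c) (hc : ∀ y, ENNReal.ofReal c⁻¹ ≤ U {y}) (a : Finset ι × Finset ι)
    (i : ι) : entropy D U q (a ⊔ (∅, {i})) ≤ entropy D U q a + Real.log c := by
  have := hq.isProbabilityMeasure_law
  have h : entropy D U q (a ⊔ (∅, {i})) ≤
      ∫ ω, (Real.log (marginal D U a q ω).toReal + Real.log c) ∂(law D U q) := by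
    refine integral_mono_ae hq.integrable_log (hq.integrable_log.add (integrable_const _)) ?_
    filter_upwards [hq.ae_marginal_ne_zero (a := a),
      hq.ae_marginal_ne_zero (a := a ⊔ (∅, {i}))] with ω h1 h2
    have p {b} (h : marginal D U b q ω ≠ 0) : 0 < (marginal D U b q ω).toReal :=
      ENNReal.toReal_pos h (hq.marginal_ne_top ω)
    have hle := ENNReal.toReal_mono (hq.marginal_ne_top ω)
      (mul_marginal_le (D := D) (U := U) (a := a) hq.measurable hc i ω)
    rw [ENNReal.toReal_mul, ENNReal.toReal_ofReal (by positivity), inv_mul_le_iff₀ hc0] at hle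
    rw [← Real.log_mul (p h1).ne' hc0.ne', mul_comm]
    exact Real.log_le_log (p h2) hle
  rw [integral_add hq.integrable_log (integrable_const _)] at h
  simpa [entropy] using h

theorem entropy_fst (hq : IsExchangeableDensity D U q) :
    entropy D U q (Finset.univ, ∅) = 0 := by
  simp [entropy, hq.marginal_fst]

theorem entropy_bot (hq : IsExchangeableDensity D U q) : entropy D U q ⊥ = 0 := by
  simp [entropy, marginal_bot, hq.lintegral_eq_one]

theorem marginal_mapPair_apply (hq : IsExchangeableDensity D U q) (σ : Equiv.Perm ι)
    (ω : ι → X × Y) :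
    marginal D U (mapPair σ a) q ω = marginal D U a q (ω ∘ σ) := by
  rw [marginal_mapPair hq.measurable]
  simp only [hq.comp_perm]

theorem measurePreserving_law (hq : IsExchangeableDensity D U q) (σ : Equiv.Perm ι) :
    MeasurePreserving (fun ω : ι → X × Y => ω ∘ σ) (law D U q) (law D U q) := by
  have hσ := measurePreserving_comp_perm (D := D) (U := U) σ
  refine ⟨hσ.measurable, Measure.ext_of_lintegral _ fun g hg => ?_⟩
  have h := hσ.lintegral_comp (f := fun ω => g ω * q ω) (hg.mul hq.measurable)
  simp only [hq.comp_perm] at h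
  rw [lintegral_map hg hσ.measurable, hq.lintegral_law (by exact hg.comp hσ.measurable),
    hq.lintegral_law hg, h]

theorem entropy_mapPair (hq : IsExchangeableDensity D U q) (σ : Equiv.Perm ι)
    (a : Finset ι × Finset ι) : entropy D U q (mapPair σ a) = entropy D U q a := by
  simp only [entropy, hq.marginal_mapPair_apply]
  have h := hq.measurePreserving_law σ
  rw [← integral_map (f := fun ω => Real.log (marginal D U a q ω).toReal)
    h.measurable.aemeasurable hq.measurable_log_marginal.aestronglyMeasurable, h.map_eq]

end IsExchangeableDensity

end Entropy

/-! ### Convex sequences -/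

section Convexity

variable {h : ℕ → ℝ} {m : ℕ}

theorem increment_mono (hconv : ∀ k, k + 2 ≤ m → 2 * h (k + 1) ≤ h (k + 2) + h k) {k l : ℕ}
    (hkl : k ≤ l) (hl : l + 1 ≤ m) : h (k + 1) - h k ≤ h (l + 1) - h l := by
  induction l, hkl using Nat.le_induction with
  | base => exact le_rfl
  | succ l _ ih =>
    have h1 := hconv l hl
    have h2 := ih (by omega)
    have : h (l + 1 + 1) = h (l + 2) := rfl
    linarith

theorem mul_increment_le (hconv : ∀ k, k + 2 ≤ m → 2 * h (k + 1) ≤ h (k + 2) + h k) (k j : ℕ)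
    (hj : k + j ≤ m) : j * (h (k + 1) - h k) ≤ h (k + j) - h k := by
  induction j with
  | zero => simp
  | succ j ih =>
    have h1 := increment_mono hconv (Nat.le_add_right k j) (by omega)
    have h2 := ih (by omega)
    have : h (k + (j + 1)) = h (k + j + 1) := rfl
    push_cast
    linarith

theorem le_mul_increment (hconv : ∀ k, k + 2 ≤ m → 2 * h (k + 1) ≤ h (k + 2) + h k) (k j l : ℕ)
    (hj : k + j ≤ l) (hl : l + 1 ≤ m) : h (k + j) - h k ≤ j * (h (l + 1) - h l) := by
  induction j with
  | zero => simp
  | succ j ih =>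
    have h1 := increment_mono hconv (show k + j ≤ l by omega) hl
    have h2 := ih (by omega)
    have : h (k + (j + 1)) = h (k + j + 1) := rfl
    push_cast
    linarith

/-- A convex sequence starting at `0` and bounded by `m * l` at `m` is nearly linear on some block
of length `n`. -/
theorem exists_nearly_linear (hconv : ∀ k, k + 2 ≤ m → 2 * h (k + 1) ≤ h (k + 2) + h k)
    (h0 : h 0 = 0) (hnn : ∀ k ≤ m, 0 ≤ h k) {l : ℝ} (hm : h m ≤ m * l) {n J : ℕ}
    (hn : 0 < n) (hJ : 0 < J) (hnJ : 2 * (n * J) ≤ m) :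
    ∃ j < J, h (n * j + n) - h (n * j) - n * (h (n * j + 1) - h (n * j)) ≤ 2 * n * l / J := by
  have hpos : 0 < n * J := Nat.mul_pos hn hJ
  set Δ : ℕ → ℝ := fun k => h (k + 1) - h k with hΔ
  -- After `n * J ≤ m / 2` there remain at least `m / 2` steps with at least this slope, while the
  -- total rise is at most `m * l`.
  have htop : Δ (n * J) ≤ 2 * l := by
    have h1 := mul_increment_le hconv (n * J) (m - n * J) (by omega)
    rw [Nat.add_sub_cancel' (by omega), Nat.cast_sub (by omega)] at h1
    have h2 := hnn (n * J) (by omega)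
    have h3 : (2 : ℝ) * ((n * J : ℕ) : ℝ) ≤ m := by exact_mod_cast hnJ
    have h4 : (0 : ℝ) < ((n * J : ℕ) : ℝ) := by exact_mod_cast hpos
    have h5 := hnn m le_rfl
    have h6 : ((m : ℝ) - ((n * J : ℕ) : ℝ)) * Δ (n * J) ≤ m * l := by
      simp only [hΔ]; linarith
    by_contra hlt
    push Not at hlt
    have h7 : 0 ≤ l := nonneg_of_mul_nonneg_right (h5.trans hm) (by linarith)
    nlinarith
  have h0' : 0 ≤ Δ 0 := by
    have := hnn 1 (by omega)
    simp only [hΔ, h0]; simpa using this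
  -- The slope increases over the `J` blocks telescope to at most `2 * l`, so on some block the
  -- slope grows by at most `2 * l / J`.
  have hsum : ∑ j ∈ Finset.range J, (Δ (n * (j + 1)) - Δ (n * j)) ≤
      ∑ _j ∈ Finset.range J, 2 * l / J := by
    rw [Finset.sum_range_sub (fun j => Δ (n * j))]
    simp only [Finset.sum_const, Finset.card_range, nsmul_eq_mul, mul_zero]
    rw [mul_div_cancel₀ _ (by positivity)]
    linarith
  obtain ⟨j, hj, hle⟩ := Finset.exists_le_of_sum_le (Finset.nonempty_range_iff.2 hJ.ne') hsum
  have hj' : j < J := Finset.mem_range.1 hj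
  refine ⟨j, hj', ?_⟩
  have hle2 : n * (j + 1) ≤ n * J := Nat.mul_le_mul_left n hj'
  have h1 := le_mul_increment hconv (n * j) n (n * (j + 1)) (by rw [mul_add, mul_one])
    (by omega)
  have hn' : (0 : ℝ) < n := by exact_mod_cast hn
  calc h (n * j + n) - h (n * j) - n * (h (n * j + 1) - h (n * j))
      ≤ n * (Δ (n * (j + 1)) - Δ (n * j)) := by simp only [hΔ] at h1 ⊢; linarith
    _ ≤ n * (2 * l / J) := by gcongr
    _ = _ := by ring

end Convexity

/-! ### Entropy bounds from exchangeability -/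

section EntropyBounds

variable {ι X Y : Type*} [Fintype ι] [DecidableEq ι] [MeasurableSpace X] [MeasurableSpace Y]
  {D : Measure X} {U : Measure Y} [IsProbabilityMeasure D] [IsProbabilityMeasure U]
  {q : (ι → X × Y) → ℝ≥0∞}

theorem exists_perm_map_eq {A B : Finset ι} (h : A.card = B.card) :
    ∃ σ : Equiv.Perm ι, A.map σ.toEmbedding = B := by
  refine ⟨(Finset.equivOfCardEq h).extendSubtype, ?_⟩
  refine Finset.eq_of_subset_of_card_le (fun x hx => ?_) (by rw [Finset.card_map, h])
  obtain ⟨y, hy, rfl⟩ := Finset.mem_map.1 hx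
  exact (Finset.equivOfCardEq h).extendSubtype_mem y hy

namespace IsExchangeableDensity

theorem exists_entropy_eq (hq : IsExchangeableDensity D U q) :
    ∃ h : ℕ → ℝ, ∀ A : Finset ι, entropy D U q (A, A) = h A.card := by
  classical
  refine ⟨fun k => if hk : ∃ A : Finset ι, A.card = k then
    entropy D U q (hk.choose, hk.choose) else 0, fun A => ?_⟩
  have hk : ∃ B : Finset ι, B.card = A.card := ⟨A, rfl⟩
  obtain ⟨σ, hσ⟩ := exists_perm_map_eq hk.choose_spec
  have := hq.entropy_mapPair σ (hk.choose, hk.choose)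
  simp only [mapPair, hσ] at this
  simp [hk, this]

/-- Supermodularity for `A ∪ {i}` and `A ∪ {j}`, which have equal entropy by exchangeability. -/
theorem entropy_convex (hq : IsExchangeableDensity D U q) {h : ℕ → ℝ}
    (hh : ∀ A : Finset ι, entropy D U q (A, A) = h A.card) (k : ℕ)
    (hk : k + 2 ≤ Fintype.card ι) : 2 * h (k + 1) ≤ h (k + 2) + h k := by
  obtain ⟨B, -, hB⟩ := Finset.exists_subset_card_eq (s := (Finset.univ : Finset ι))
    (n := k + 2) (by simpa using hk)
  obtain ⟨i, A', hi, rfl, hA'⟩ := Finset.card_eq_succ.1 hB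
  obtain ⟨j, A, hj, rfl, hA⟩ := Finset.card_eq_succ.1 hA'
  have hij : i ≠ j := fun h => hi (by simp [h])
  have hiA : i ∉ A := fun h => hi (Finset.mem_insert_of_mem h)
  have hsup : (insert i A, insert i A) ⊔ (insert j A, insert j A) =
      (insert i (insert j A), insert i (insert j A)) := by
    have : insert i A ∪ insert j A = insert i (insert j A) := by ext; simp; tauto
    ext1 <;> simp [this]
  have hinf : (insert i A, insert i A) ⊓ (insert j A, insert j A) = (A, A) := by
    have : insert i A ∩ insert j A = A := by
      ext x; simp only [Finset.mem_inter, Finset.mem_insert]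
      constructor
      · rintro ⟨rfl | h1, h2 | h2⟩ <;> first | assumption | (exact absurd h2 hij)
      · intro h; exact ⟨Or.inr h, Or.inr h⟩
    ext1 <;> simp [this]
  have hs := hq.entropy_supermodular (insert i A, insert i A) (insert j A, insert j A)
  rw [hsup, hinf, hh, hh, hh, hh, hB, hA', hA, Finset.card_insert_of_notMem hiA, hA] at hs
  linarith

/-- All the points together have entropy `0`, being i.i.d. with law `D`; the labels are then
revealed one at a time. -/
theorem entropy_labels_le [MeasurableSingletonClass Y] (hq : IsExchangeableDensity D U q)
    {c : ℝ} (hc0 : 0 < c) (hc : ∀ y, ENNReal.ofReal c⁻¹ ≤ U {y}) (B : Finset ι) :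
    entropy D U q (Finset.univ, B) ≤ B.card * Real.log c := by
  induction B using Finset.induction_on with
  | empty => simp [hq.entropy_fst]
  | insert i B hi ih =>
    have h := hq.entropy_sup_label_le hc0 hc (Finset.univ, B) i
    have e : ((Finset.univ, B) : Finset ι × Finset ι) ⊔ (∅, {i}) = (Finset.univ, insert i B) := by
      ext1
      · simp
      · simp
    rw [e] at h
    rw [Finset.card_insert_of_notMem hi]
    push_cast
    linarith

/-- The increment is the information that `A` carries about one further point. The points are
independent under the reference measure, so supermodularity makes these increments superadditive; by
symmetry they are equal. Together they cannot exceed the entropy of all points with the labels in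
`A`. -/
theorem mul_entropy_increment_fst_le [MeasurableSingletonClass Y]
    (hq : IsExchangeableDensity D U q) {c : ℝ} (hc0 : 0 < c)
    (hc : ∀ y, ENNReal.ofReal c⁻¹ ≤ U {y}) {A : Finset ι} {i : ι} (hi : i ∉ A) :
    (Fintype.card ι - A.card) * (entropy D U q (insert i A, A) - entropy D U q (A, A)) ≤
      A.card * Real.log c := by
  set κ := entropy D U q (insert i A, A) - entropy D U q (A, A) with hκ
  have hsymm (j : ι) (hj : j ∉ A) :
      entropy D U q (insert j A, A) = entropy D U q (insert i A, A) := by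
    rw [← hq.entropy_mapPair (Equiv.swap i j) (insert i A, A)]
    have hA : A.map (Equiv.swap i j).toEmbedding = A := by
      refine Finset.eq_of_subset_of_card_le (fun x hx => ?_) (by rw [Finset.card_map])
      obtain ⟨y, hy, rfl⟩ := Finset.mem_map.1 hx
      have h1 : y ≠ i := fun h => hi (h ▸ hy)
      have h2 : y ≠ j := fun h => hj (h ▸ hy)
      simpa [Equiv.swap_apply_of_ne_of_ne h1 h2] using hy
    simp [mapPair, Finset.map_insert, hA]
  have key (T : Finset ι) (hT : Disjoint A T) :
      T.card * κ ≤ entropy D U q (A ∪ T, A) - entropy D U q (A, A) := by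
    induction T using Finset.induction_on with
    | empty => simp
    | insert j T hj ih =>
      rw [Finset.disjoint_insert_right] at hT
      have h1 := ih hT.2
      have hs := hq.entropy_supermodular (insert j A, A) (A ∪ T, A)
      have hsup : ((insert j A, A) : Finset ι × Finset ι) ⊔ (A ∪ T, A) = (A ∪ insert j T, A) := by
        have : insert j A ∪ (A ∪ T) = A ∪ insert j T := by ext; simp
        ext1 <;> simp [this]
      have hinf : ((insert j A, A) : Finset ι × Finset ι) ⊓ (A ∪ T, A) = (A, A) := by
        have : insert j A ∩ (A ∪ T) = A := by
          ext x; simp only [Finset.mem_inter, Finset.mem_insert, Finset.mem_union]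
          constructor
          · rintro ⟨rfl | h1, h2⟩
            · exact h2.resolve_right hj
            · exact h1
          · intro h; exact ⟨Or.inr h, Or.inl h⟩
        ext1 <;> simp [this]
      rw [hsup, hinf, hsymm j hT.1] at hs
      rw [Finset.card_insert_of_notMem hj]
      push_cast
      linarith
  have h := key Aᶜ disjoint_compl_right
  rw [Finset.union_compl, Finset.card_compl, Nat.cast_sub (Finset.card_le_univ A)] at h
  have h2 := hq.entropy_labels_le hc0 hc A
  have h3 := hq.entropy_nonneg (A, A)
  linarith

/-- Conditionally on the components in a suitable set `A` of moderate size, `n` further components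
are nearly independent. -/
theorem exists_pinning [MeasurableSingletonClass Y] (hq : IsExchangeableDensity D U q)
    {c : ℝ} (hc0 : 0 < c) (hc : ∀ y, ENNReal.ofReal c⁻¹ ≤ U {y}) {n J : ℕ} (hn : 0 < n)
    (hJ : 0 < J) (hnJ : 2 * (n * J) ≤ Fintype.card ι) :
    ∃ (A : Finset ι) (e : Fin n ↪ ι), A.card ≤ n * J ∧ (∀ j, e j ∉ A) ∧
      entropy D U q (A ∪ Finset.univ.map e, A ∪ Finset.univ.map e) - entropy D U q (A, A) -
        ∑ j, (entropy D U q (insert (e j) A, insert (e j) A) - entropy D U q (A, A)) ≤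
        2 * n * Real.log c / J := by
  obtain ⟨h, hh⟩ := hq.exists_entropy_eq
  have hcard {k : ℕ} (hk : k ≤ Fintype.card ι) : ∃ A : Finset ι, A.card = k := by
    obtain ⟨A, -, hA⟩ := Finset.exists_subset_card_eq (s := (Finset.univ : Finset ι))
      (n := k) (by simpa using hk)
    exact ⟨A, hA⟩
  have h0 : h 0 = 0 := by
    rw [← Finset.card_empty (α := ι), ← hh]; exact hq.entropy_bot
  have hnn (k) (hk : k ≤ Fintype.card ι) : 0 ≤ h k := by
    obtain ⟨A, rfl⟩ := hcard hk
    rw [← hh]; exact hq.entropy_nonneg _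
  have htop : h (Fintype.card ι) ≤ Fintype.card ι * Real.log c := by
    rw [← Finset.card_univ, ← hh]; exact hq.entropy_labels_le hc0 hc Finset.univ
  -- The deviation from linearity on a block is the total correlation of `n` components given the
  -- preceding ones; the sets `A ⊆ B` realize the two ends of the block.
  obtain ⟨j, hj, hle⟩ := exists_nearly_linear (hq.entropy_convex hh) h0 hnn htop hn hJ hnJ
  have hj1 : n * (j + 1) ≤ n * J := Nat.mul_le_mul_left n hj
  have hj2 : n * (j + 1) = n * j + n := by ring
  obtain ⟨B, hB⟩ := hcard (k := n * j + n) (by omega)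
  obtain ⟨A, hAB, hA⟩ := Finset.exists_subset_card_eq (s := B) (n := n * j) (by omega)
  have hT : (B \ A).card = n := by rw [Finset.card_sdiff_of_subset hAB]; omega
  set e : Fin n ↪ ι := ((B \ A).equivFinOfCardEq hT).symm.toEmbedding.trans
    (Function.Embedding.subtype _) with he
  have hmem (j) : e j ∈ B \ A := (((B \ A).equivFinOfCardEq hT).symm j).2
  have hmap : Finset.univ.map e = B \ A :=
    Finset.eq_of_subset_of_card_le (fun x hx => by
      obtain ⟨y, -, rfl⟩ := Finset.mem_map.1 hx; exact hmem y) (by simp [hT])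
  refine ⟨A, e, by omega, fun j => (Finset.mem_sdiff.1 (hmem j)).2, ?_⟩
  rw [hmap, Finset.union_sdiff_of_subset hAB, hh, hh, hA, hB]
  have (i : Fin n) : entropy D U q (insert (e i) A, insert (e i) A) = h (n * j + 1) := by
    rw [hh, Finset.card_insert_of_notMem (Finset.mem_sdiff.1 (hmem i)).2, hA]
  simp only [this, Finset.sum_const, Finset.card_univ, Fintype.card_fin, nsmul_eq_mul]
  exact hle

end IsExchangeableDensity

end EntropyBounds

/-! ### Conditioning on the components in `A` -/

section Conditioning

variable {ι X Y : Type*} [Fintype ι] [DecidableEq ι] [MeasurableSpace X] [MeasurableSpace Y]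
  {D : Measure X} {U : Measure Y} [IsProbabilityMeasure D] [IsProbabilityMeasure U]
  {q : (ι → X × Y) → ℝ≥0∞} {a b : Finset ι × Finset ι}

theorem marginal_congr {ω ω' : ι → X × Y} (h1 : ∀ k ∈ a.1, (ω k).1 = (ω' k).1)
    (h2 : ∀ k ∈ a.2, (ω k).2 = (ω' k).2) : marginal D U a q ω = marginal D U a q ω' := by
  have (τ : ι → X × Y) : splice a ω τ = splice a ω' τ := by
    funext k
    simp only [splice]
    ext
    · by_cases hk : k ∈ a.1
      · simp [hk, h1 k hk]
      · simp [hk]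
    · by_cases hk : k ∈ a.2
      · simp [hk, h2 k hk]
      · simp [hk]
  simp only [marginal, this]

/-- The joint density of the components of `ω` indexed by `A` and of `z`, put at an index `i`. -/
noncomputable def nextDensity (D : Measure X) (U : Measure Y) (q : (ι → X × Y) → ℝ≥0∞)
    (A : Finset ι) (i : ι) (ω : ι → X × Y) (z : X × Y) : ℝ≥0∞ :=
  marginal D U (insert i A, insert i A) q (Function.update ω i z)

/-- The joint density of the components of `ω` indexed by `A` and of a first component `x`, put
at an index `i`. -/
noncomputable def nextFstDensity (D : Measure X) (U : Measure Y) (q : (ι → X × Y) → ℝ≥0∞)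
    (A : Finset ι) (i : ι) (ω : ι → X × Y) (x : X) : ℝ≥0∞ :=
  marginal D U (insert i A, A) q (Function.update ω i (x, (ω i).2))

variable {A : Finset ι} {i : ι}

theorem nextFstDensity_splice (hi : i ∉ A) (ω ω' : ι → X × Y) :
    marginal D U (insert i A, A) q (splice (A, A) ω ω') =
      nextFstDensity D U q A i ω (ω' i).1 := by
  refine marginal_congr (fun k hk => ?_) fun k hk => ?_
  · rcases Finset.mem_insert.1 hk with rfl | hk
    · simp [splice, hi]
    · have : k ≠ i := fun h => hi (h ▸ hk)
      simp [splice, hk, this]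
  · have hk : k ∈ A := hk
    have : k ≠ i := fun h => hi (h ▸ hk)
    simp [splice, hk, this]

namespace IsExchangeableDensity

theorem measurable_nextDensity (hq : IsExchangeableDensity D U q) (ω : ι → X × Y) :
    Measurable (nextDensity D U q A i ω) :=
  (measurable_marginal hq.measurable).comp (measurable_update ω)

theorem measurable_nextFstDensity (hq : IsExchangeableDensity D U q) (ω : ι → X × Y) :
    Measurable (nextFstDensity D U q A i ω) :=
  (measurable_marginal hq.measurable).comp
    ((measurable_update ω).comp (measurable_id.prodMk measurable_const))

/-- By exchangeability the density at any index outside `A` is the one at the reference index `i`.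
The conditional factors are therefore identical, and their product describes an i.i.d. sample. -/
theorem nextDensity_splice (hq : IsExchangeableDensity D U q) (hi : i ∉ A) {j : ι} (hj : j ∉ A)
    (ω ω' : ι → X × Y) :
    marginal D U (insert j A, insert j A) q (splice (A, A) ω ω') =
      nextDensity D U q A i ω (ω' j) := by
  have hA : A.map (Equiv.swap i j).toEmbedding = A := by
    refine Finset.eq_of_subset_of_card_le (fun x hx => ?_) (by rw [Finset.card_map])
    obtain ⟨y, hy, rfl⟩ := Finset.mem_map.1 hx
    have h1 : y ≠ i := fun h => hi (h ▸ hy)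
    have h2 : y ≠ j := fun h => hj (h ▸ hy)
    simpa [Equiv.swap_apply_of_ne_of_ne h1 h2] using hy
  have hmap : mapPair (Equiv.swap i j) (insert i A, insert i A) = (insert j A, insert j A) := by
    simp [mapPair, Finset.map_insert, hA]
  rw [← hmap, hq.marginal_mapPair_apply, nextDensity]
  have h (k) (hk : k ∈ insert i A) :
      (splice (A, A) ω ω' ∘ Equiv.swap i j) k = Function.update ω i (ω' j) k := by
    rcases Finset.mem_insert.1 hk with rfl | hk
    · simp [splice, hj]
    · have h1 : k ≠ i := fun h => hi (h ▸ hk)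
      have h2 : k ≠ j := fun h => hj (h ▸ hk)
      simp [splice, hk, h1, Equiv.swap_apply_of_ne_of_ne h1 h2]
  exact marginal_congr (fun k hk => by rw [h k hk]) fun k hk => by rw [h k hk]

theorem lintegral_mul_nextDensity (hq : IsExchangeableDensity D U q) (hi : i ∉ A) {j : ι}
    (hj : j ∉ A) {R : X × Y → ℝ≥0∞} (hR : Measurable R) (ω : ι → X × Y) :
    ∫⁻ z, R z * nextDensity D U q A i ω z ∂(D.prod U) =
      marginal D U (A, A) (fun ω => R (ω j) * q ω) ω := by
  have hRj : Measurable fun ω : ι → X × Y => R (ω j) := hR.comp (measurable_pi_apply j)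
  have hle : ((A, A) : Finset ι × Finset ι) ⊓ (insert j A, insert j A) = (A, A) :=
    inf_eq_left.2 ⟨Finset.subset_insert _ _, Finset.subset_insert _ _⟩
  have h1 := marginal_marginal (D := D) (U := U) (a := (A, A)) (b := (insert j A, insert j A))
    (q := fun ω => R (ω j) * q ω) (hRj.mul hq.measurable) ω
  rw [hle] at h1
  have h2 : marginal D U (insert j A, insert j A) (fun ω => R (ω j) * q ω) =
      fun ω => R (ω j) * marginal D U (insert j A, insert j A) q ω := by
    funext τ
    exact marginal_mul (g := fun ω => R (ω j)) hq.measurable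
      (fun ω ω' => by simp [splice]) τ
  rw [← h1, h2, marginal]
  simp only [hq.nextDensity_splice hi hj]
  have h3 (ω' : ι → X × Y) : splice (A, A) ω ω' j = ω' j := by simp [splice, hj]
  simp only [h3]
  exact ((measurePreserving_eval (fun _ : ι => D.prod U) j).lintegral_comp
    (f := fun z => R z * nextDensity D U q A i ω z)
    (hR.mul (hq.measurable_nextDensity ω))).symm

theorem lintegral_nextDensity (hq : IsExchangeableDensity D U q) (hi : i ∉ A) (ω : ι → X × Y) :
    ∫⁻ z, nextDensity D U q A i ω z ∂(D.prod U) = marginal D U (A, A) q ω := by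
  simpa using hq.lintegral_mul_nextDensity hi hi (R := fun _ => 1) measurable_const ω

theorem lintegral_nextDensity_snd (hq : IsExchangeableDensity D U q) (hi : i ∉ A)
    (ω : ι → X × Y) (x : X) :
    ∫⁻ y, nextDensity D U q A i ω (x, y) ∂U = nextFstDensity D U q A i ω x := by
  have hle : ((insert i A, A) : Finset ι × Finset ι) ⊓ (insert i A, insert i A) =
      (insert i A, A) := inf_eq_left.2 ⟨le_rfl, Finset.subset_insert _ _⟩
  have h1 := marginal_marginal (D := D) (U := U) (a := (insert i A, A))
    (b := (insert i A, insert i A)) hq.measurable (Function.update ω i (x, (ω i).2))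
  rw [hle] at h1
  rw [nextFstDensity, ← h1, marginal]
  have h2 (ω' : ι → X × Y) : marginal D U (insert i A, insert i A) q
      (splice (insert i A, A) (Function.update ω i (x, (ω i).2)) ω') =
      nextDensity D U q A i ω (x, (ω' i).2) := by
    refine marginal_congr (fun k hk => ?_) fun k hk => ?_
    · have hk : k ∈ insert i A := hk
      simp only [splice, hk, if_true]
      by_cases h : k = i
      · subst h; simp
      · simp [h]
    · rcases Finset.mem_insert.1 hk with rfl | hk
      · simp [splice, hi]
      · have : k ≠ i := fun h => hi (h ▸ hk)
        simp [splice, hk, this]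
  simp only [h2]
  have hm : Measurable fun y => nextDensity D U q A i ω (x, y) :=
    (hq.measurable_nextDensity ω).comp measurable_prodMk_left
  exact (((measurePreserving_snd (μ := D) (ν := U)).comp
    (measurePreserving_eval (fun _ : ι => D.prod U) i)).lintegral_comp hm).symm

/-- After resampling everything outside `A`, the point at `i` is a fresh draw from `D`. Thus the
average deviation of the next point's conditional law from `D` becomes a difference of two
marginals, to which the entropy bound applies. -/
theorem lintegral_nextFstDensity_sub (hq : IsExchangeableDensity D U q) (hi : i ∉ A) :
    ∫⁻ ω, ∫⁻ x, (nextFstDensity D U q A i ω x - marginal D U (A, A) q ω) ∂D ∂(iid ι D U) =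
      ∫⁻ ω, (marginal D U (insert i A, A) q ω - marginal D U (A, A) q ω) ∂(iid ι D U) := by
  have hm := fun a : Finset ι × Finset ι => measurable_marginal (D := D) (U := U) (a := a)
    hq.measurable
  rw [← lintegral_splice (a := (A, A)) (q := fun ω => marginal D U (insert i A, A) q ω -
    marginal D U (A, A) q ω) ((hm _).sub (hm _))]
  refine lintegral_congr fun ω => ?_
  simp only [nextFstDensity_splice hi, marginal_splice le_rfl]
  have hx : Measurable fun x => nextFstDensity D U q A i ω x - marginal D U (A, A) q ω :=
    (hq.measurable_nextFstDensity ω).sub_const _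
  exact (((measurePreserving_fst (μ := D) (ν := U)).comp
    (measurePreserving_eval (fun _ : ι => D.prod U) i)).lintegral_comp hx).symm

/-- The density under which the components in `A` have their joint law, and the components indexed
by `e` are independent given those. -/
theorem lintegral_conditional_product (hq : IsExchangeableDensity D U q) (hi : i ∉ A) {n : ℕ}
    (e : Fin n ↪ ι) (he : ∀ j, e j ∉ A) {f : (Fin n → X × Y) → ℝ≥0∞} (hf : Measurable f) :
    ∫⁻ ω, f (fun j => ω (e j)) * (marginal D U (A, A) q ω * ∏ j, ((marginal D U (A, A) q ω)⁻¹ *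
        marginal D U (insert (e j) A, insert (e j) A) q ω)) ∂(iid ι D U) =
      ∫⁻ ω, marginal D U (A, A) q ω * ∫⁻ w, (∏ j, ((marginal D U (A, A) q ω)⁻¹ *
        nextDensity D U q A i ω (w j))) * f w ∂(Measure.pi fun _ => D.prod U) ∂(iid ι D U) := by
  have hm := fun a : Finset ι × Finset ι => measurable_marginal (D := D) (U := U) (a := a)
    hq.measurable
  have hfe : Measurable fun ω : ι → X × Y => f fun j => ω (e j) :=
    hf.comp (measurable_pi_lambda _ fun j => measurable_pi_apply (e j))
  have hv : Measurable fun ω => marginal D U (A, A) q ω * ∏ j, ((marginal D U (A, A) q ω)⁻¹ *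
      marginal D U (insert (e j) A, insert (e j) A) q ω) :=
    (hm _).mul (Finset.measurable_fun_prod _ fun j _ => (hm _).inv.mul (hm _))
  rw [← lintegral_splice (a := (A, A)) (by exact hfe.mul hv)]
  refine lintegral_congr fun ω => ?_
  simp only [marginal_splice le_rfl, hq.nextDensity_splice hi (he _)]
  have h3 (ω' : ι → X × Y) (j) : splice (A, A) ω ω' (e j) = ω' (e j) := by simp [splice, he]
  simp only [h3]
  have hG : Measurable fun w : Fin n → X × Y => (∏ j, ((marginal D U (A, A) q ω)⁻¹ *
      nextDensity D U q A i ω (w j))) * f w := by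
    have := hq.measurable_nextDensity (A := A) (i := i) ω
    fun_prop
  have hmp := measurePreserving_pi_comp_injective (D.prod U) e.injective
  rw [← hmp.lintegral_comp hG, ← lintegral_const_mul _ (by exact hG.comp hmp.measurable)]
  refine lintegral_congr fun ω' => ?_
  exact (mul_comm _ _).trans (mul_assoc _ _ _)

/-- The Pinsker-type bound for `r = v / p`, with `p` the marginal density on `b`; the entropy term
is the relative entropy of the law with respect to `v`. -/
theorem lintegral_marginal_sub_le (hq : IsExchangeableDensity D U q) {v : (ι → X × Y) → ℝ≥0∞}
    (hv : Measurable v) (hdep : ∀ ω ω', v (splice b ω ω') = v ω)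
    (hv1 : ∫⁻ ω, v ω ∂(iid ι D U) ≤ 1) (hv0 : ∀ᵐ ω ∂(law D U q), v ω ≠ 0)
    (hlog : Integrable (fun ω => Real.log (v ω).toReal) (law D U q)) {t : ℝ} (ht : 0 < t) :
    ∫⁻ ω, (marginal D U b q ω - v ω) ∂(iid ι D U) ≤
      ENNReal.ofReal ((entropy D U q b - ∫ ω, Real.log (v ω).toReal ∂(law D U q)) / t + t) := by
  have := hq.isProbabilityMeasure_law
  have hm : Measurable (marginal D U b q) := measurable_marginal hq.measurable
  have hvtop : ∀ᵐ ω ∂(law D U q), v ω < ∞ :=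
    (withDensity_absolutelyContinuous _ _).ae_le
      (ae_lt_top hv (ne_top_of_le_ne_top ENNReal.one_ne_top hv1))
  set r : (ι → X × Y) → ℝ≥0∞ := fun ω => v ω * (marginal D U b q ω)⁻¹ with hr
  have hrm : Measurable r := hv.mul hm.inv
  have hrdep (ω ω') : r (splice b ω ω') = r ω := by
    simp only [hr, hdep, marginal_splice le_rfl]
  have hrlog : (fun ω => Real.log (r ω).toReal) =ᵐ[law D U q] fun ω =>
      Real.log (v ω).toReal - Real.log (marginal D U b q ω).toReal := by
    filter_upwards [hq.ae_marginal_ne_zero (a := b), hv0, hvtop] with ω h1 h2 h3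
    simp only [hr, ENNReal.toReal_mul, ENNReal.toReal_inv]
    rw [Real.log_mul (ENNReal.toReal_pos h2 h3.ne).ne'
      (inv_ne_zero (ENNReal.toReal_pos h1 (hq.marginal_ne_top ω)).ne'), Real.log_inv]
    ring
  have hr1 : ∫⁻ ω, r ω ∂(law D U q) ≤ 1 := by
    rw [hq.lintegral_law_of_dep (a := b) hrm hrdep]
    refine le_trans (lintegral_mono fun ω => ?_) hv1
    simp only [hr]
    rw [mul_assoc]
    exact mul_le_of_le_one_right' (ENNReal.inv_mul_le_one _)
  have hr0 : ∀ᵐ ω ∂(law D U q), r ω ≠ 0 := by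
    filter_upwards [hv0] with ω h
    exact mul_ne_zero h (ENNReal.inv_ne_zero.2 (hq.marginal_ne_top ω))
  have hmain := lintegral_one_sub_le_of_log hrm hr1 hr0
    ((integrable_congr hrlog).2 (hlog.sub hq.integrable_log)) ht
  have hint : ∫ ω, -Real.log (r ω).toReal ∂(law D U q) =
      entropy D U q b - ∫ ω, Real.log (v ω).toReal ∂(law D U q) := by
    rw [integral_neg, integral_congr_ae hrlog, integral_sub hlog hq.integrable_log, entropy]
    ring
  rw [hint] at hmain
  refine le_trans ?_ hmain
  rw [hq.lintegral_law_of_dep (a := b) (hrm.const_sub 1) fun ω ω' => by simp only [hrdep]]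
  refine lintegral_mono fun ω => ?_
  rcases eq_or_ne (marginal D U b q ω) 0 with h | h
  · simp [h]
  · rw [ENNReal.sub_mul fun _ _ => hq.marginal_ne_top ω, one_mul]
    simp only [hr]
    rw [mul_assoc, ENNReal.inv_mul_cancel h (hq.marginal_ne_top ω), mul_one]

/-- The comparison density `v` is the marginal on `A` alone, which corresponds to a further point
independent of `A` with law `D`. -/
theorem lintegral_fst_excess_le (hq : IsExchangeableDensity D U q) {t : ℝ} (ht : 0 < t) :
    ∫⁻ ω, (marginal D U (insert i A, A) q ω - marginal D U (A, A) q ω) ∂(iid ι D U) ≤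
      ENNReal.ofReal ((entropy D U q (insert i A, A) - entropy D U q (A, A)) / t + t) := by
  have hle : ((A, A) : Finset ι × Finset ι) ≤ (insert i A, A) :=
    ⟨Finset.subset_insert _ _, le_rfl⟩
  exact hq.lintegral_marginal_sub_le (measurable_marginal hq.measurable)
    (fun ω ω' => marginal_splice hle _ _)
    (by rw [lintegral_marginal hq.measurable, hq.lintegral_eq_one]) hq.ae_marginal_ne_zero
    hq.integrable_log ht

/-- The comparison density `v` makes the components indexed by `e` conditionally independent given
`A`, so the relative entropy is their conditional total correlation. Since `f ≤ 1`, replacing the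
true density by `v` loses at most the integral of the positive part of the difference. -/
theorem lintegral_law_le_conditional_product (hq : IsExchangeableDensity D U q) {n : ℕ}
    (e : Fin n ↪ ι) (he : ∀ j, e j ∉ A) (hi : i ∉ A) {f : (Fin n → X × Y) → ℝ≥0∞}
    (hf : Measurable f) (hf1 : ∀ w, f w ≤ 1) {t : ℝ} (ht : 0 < t) :
    ∫⁻ ω, f (fun j => ω (e j)) ∂(law D U q) ≤
      ∫⁻ ω, marginal D U (A, A) q ω * ∫⁻ w, (∏ j, ((marginal D U (A, A) q ω)⁻¹ *
        nextDensity D U q A i ω (w j))) * f w ∂(Measure.pi fun _ => D.prod U) ∂(iid ι D U) +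
      ENNReal.ofReal ((entropy D U q (A ∪ Finset.univ.map e, A ∪ Finset.univ.map e) -
        entropy D U q (A, A) - ∑ j, (entropy D U q (insert (e j) A, insert (e j) A) -
          entropy D U q (A, A))) / t + t) := by
  have hm := fun a : Finset ι × Finset ι => measurable_marginal (D := D) (U := U) (a := a)
    hq.measurable
  set B := A ∪ Finset.univ.map e with hB
  have heB (j) : e j ∈ B := by simp [hB]
  have hAB : ((A, A) : Finset ι × Finset ι) ≤ (B, B) :=
    ⟨Finset.subset_union_left, Finset.subset_union_left⟩
  have hjB (j) : ((insert (e j) A, insert (e j) A) : Finset ι × Finset ι) ≤ (B, B) :=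
    ⟨Finset.insert_subset (heB j) Finset.subset_union_left,
      Finset.insert_subset (heB j) Finset.subset_union_left⟩
  set v : (ι → X × Y) → ℝ≥0∞ := fun ω => marginal D U (A, A) q ω *
    ∏ j, ((marginal D U (A, A) q ω)⁻¹ * marginal D U (insert (e j) A, insert (e j) A) q ω) with hv
  have hvm : Measurable v :=
    (hm _).mul (Finset.measurable_fun_prod _ fun j _ => (hm _).inv.mul (hm _))
  have hvdep (ω ω') : v (splice (B, B) ω ω') = v ω := by
    simp only [hv, marginal_splice hAB, marginal_splice (hjB _)]
  have hfe : Measurable fun ω : ι → X × Y => f fun j => ω (e j) :=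
    hf.comp (measurable_pi_lambda _ fun j => measurable_pi_apply (e j))
  have hfdep (ω ω' : ι → X × Y) :
      f (fun j => splice (B, B) ω ω' (e j)) = f fun j => ω (e j) := by
    have h (j : Fin n) : splice (B, B) ω ω' (e j) = ω (e j) := by simp [splice, heB]
    simp only [h]
  -- Given `A`, the remaining factor is a product of densities of mass at most `1`; the mass is `0`
  -- where the marginal on `A` vanishes.
  have hv1 : ∫⁻ ω, v ω ∂(iid ι D U) ≤ 1 := by
    have h := hq.lintegral_conditional_product hi e he (f := fun _ => 1) measurable_const
    simp only [one_mul, mul_one] at h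
    rw [h]
    calc _ ≤ ∫⁻ ω, marginal D U (A, A) q ω ∂(iid ι D U) := by
          refine lintegral_mono fun ω => mul_le_of_le_one_right' ?_
          have hp : Measurable fun z => (marginal D U (A, A) q ω)⁻¹ *
              nextDensity D U q A i ω z := (hq.measurable_nextDensity ω).const_mul _
          have hmass : ∫⁻ z, (marginal D U (A, A) q ω)⁻¹ *
              nextDensity D U q A i ω z ∂(D.prod U) ≤ 1 := by
            rw [lintegral_const_mul _ (hq.measurable_nextDensity ω),
              hq.lintegral_nextDensity hi]
            exact ENNReal.inv_mul_le_one _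
          set μ := (D.prod U).withDensity fun z => (marginal D U (A, A) q ω)⁻¹ *
              nextDensity D U q A i ω z with hμ
          have hμ1 : μ Set.univ ≤ 1 := by
            rw [hμ, withDensity_apply _ MeasurableSet.univ, Measure.restrict_univ]
            exact hmass
          have : IsFiniteMeasure μ := ⟨hμ1.trans_lt ENNReal.one_lt_top⟩
          have h := lintegral_pi_withDensity (n := n) (D.prod U) hp (f := fun _ => 1)
            measurable_const
          simp only [mul_one] at h
          rw [← h, lintegral_one, Measure.pi_univ]
          exact Finset.prod_le_one' fun _ _ => hμ1
      _ = 1 := by rw [lintegral_marginal hq.measurable, hq.lintegral_eq_one]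
  have hall : ∀ᵐ ω ∂(law D U q), ∀ j, marginal D U (insert (e j) A, insert (e j) A) q ω ≠ 0 :=
    ae_all_iff.2 fun j => hq.ae_marginal_ne_zero
  have hv0 : ∀ᵐ ω ∂(law D U q), v ω ≠ 0 := by
    filter_upwards [hq.ae_marginal_ne_zero (a := (A, A)), hall] with ω h1 h2
    exact mul_ne_zero h1 (Finset.prod_ne_zero_iff.2 fun j _ =>
      mul_ne_zero (ENNReal.inv_ne_zero.2 (hq.marginal_ne_top ω)) (h2 j))
  have hvlog : (fun ω => Real.log (v ω).toReal) =ᵐ[law D U q] fun ω =>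
      Real.log (marginal D U (A, A) q ω).toReal +
        ∑ j, (Real.log (marginal D U (insert (e j) A, insert (e j) A) q ω).toReal -
          Real.log (marginal D U (A, A) q ω).toReal) := by
    filter_upwards [hq.ae_marginal_ne_zero (a := (A, A)), hall] with ω h1 h2
    have p {c} (h : marginal D U c q ω ≠ 0) : (marginal D U c q ω).toReal ≠ 0 :=
      (ENNReal.toReal_pos h (hq.marginal_ne_top ω)).ne'
    simp only [hv, ENNReal.toReal_mul, ENNReal.toReal_inv, ENNReal.toReal_prod]
    rw [Real.log_mul (p h1) (Finset.prod_ne_zero_iff.2 fun j _ =>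
      mul_ne_zero (inv_ne_zero (p h1)) (p (h2 j))), Real.log_prod fun j _ =>
      mul_ne_zero (inv_ne_zero (p h1)) (p (h2 j))]
    congr 1
    refine Finset.sum_congr rfl fun j _ => ?_
    rw [Real.log_mul (inv_ne_zero (p h1)) (p (h2 j)), Real.log_inv]
    ring
  have hi' (c : Finset ι × Finset ι) := hq.integrable_log (a := c)
  have hsum : Integrable (fun ω =>
      ∑ j, (Real.log (marginal D U (insert (e j) A, insert (e j) A) q ω).toReal -
          Real.log (marginal D U (A, A) q ω).toReal)) (law D U q) :=
    integrable_finsetSum _ fun j _ => (hi' _).sub (hi' _)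
  have hvint : Integrable (fun ω => Real.log (v ω).toReal) (law D U q) :=
    (integrable_congr hvlog).2 ((hi' _).add hsum)
  have hE : ∫ ω, Real.log (v ω).toReal ∂(law D U q) = entropy D U q (A, A) +
      ∑ j, (entropy D U q (insert (e j) A, insert (e j) A) - entropy D U q (A, A)) := by
    rw [integral_congr_ae hvlog, integral_add (hi' _) hsum,
      integral_finsetSum _ fun j _ => by exact (hi' _).sub (hi' _)]
    congr 1
    exact Finset.sum_congr rfl fun j _ => integral_sub (hi' _) (hi' _)
  have hexc := hq.lintegral_marginal_sub_le hvm hvdep hv1 hv0 hvint ht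
  rw [hE, ← sub_sub] at hexc
  calc ∫⁻ ω, f (fun j => ω (e j)) ∂(law D U q)
      = ∫⁻ ω, f (fun j => ω (e j)) * marginal D U (B, B) q ω ∂(iid ι D U) :=
        hq.lintegral_law_of_dep hfe hfdep
    _ ≤ ∫⁻ ω, (f (fun j => ω (e j)) * v ω + (marginal D U (B, B) q ω - v ω)) ∂(iid ι D U) := by
        refine lintegral_mono fun ω => ?_
        calc f (fun j => ω (e j)) * marginal D U (B, B) q ω
            ≤ f (fun j => ω (e j)) * (v ω + (marginal D U (B, B) q ω - v ω)) := by
              gcongr; exact le_add_tsub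
          _ ≤ _ := by
              rw [mul_add]; gcongr
              exact mul_le_of_le_one_left' (hf1 _)
    _ = ∫⁻ ω, f (fun j => ω (e j)) * v ω ∂(iid ι D U) +
          ∫⁻ ω, (marginal D U (B, B) q ω - v ω) ∂(iid ι D U) :=
        lintegral_add_left (hfe.mul hvm) _
    _ ≤ _ := by
        rw [hq.lintegral_conditional_product hi e he hf]
        gcongr

end IsExchangeableDensity

end Conditioning

/-! ### From conditional independence to an oblivious corruption -/

section ObliviousFromCore

variable {ι X Y : Type*} [Fintype ι] [DecidableEq ι] [MeasurableSpace X] [MeasurableSpace Y]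
  {D : Measure X} {U : Measure Y} [IsProbabilityMeasure D] [IsProbabilityMeasure U]
  {q : (ι → X × Y) → ℝ≥0∞} {ρ : X → X → ℝ≥0∞} {G : X × Y → X} {A : Finset ι} {i : ι}

namespace IsExchangeableDensity

/-- Conditionally on the components in `A`, the expected cost of a further component exceeds the
average cost by at most the obvious factor. -/
theorem mul_lintegral_cost_le (hq : IsExchangeableDensity D U q) {R : X × Y → ℝ≥0∞}
    (hR : Measurable R) {K : ℝ≥0∞} (hlegal : ∀ ω, q ω ≠ 0 → ∑ j, R (ω j) ≤ K)
    (hi : i ∉ A) (ω : ι → X × Y) :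
    ((Fintype.card ι - A.card : ℕ) : ℝ≥0∞) * ∫⁻ z, R z * nextDensity D U q A i ω z ∂(D.prod U) ≤
      K * marginal D U (A, A) q ω := by
  have hRj (j : ι) : Measurable fun ω : ι → X × Y => R (ω j) := hR.comp (measurable_pi_apply j)
  calc ((Fintype.card ι - A.card : ℕ) : ℝ≥0∞) *
        ∫⁻ z, R z * nextDensity D U q A i ω z ∂(D.prod U)
      = ∑ j ∈ Aᶜ, ∫⁻ z, R z * nextDensity D U q A i ω z ∂(D.prod U) := by
        rw [Finset.sum_const, Finset.card_compl, nsmul_eq_mul]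
    _ = ∑ j ∈ Aᶜ, marginal D U (A, A) (fun ω => R (ω j) * q ω) ω :=
        Finset.sum_congr rfl fun j hj =>
          hq.lintegral_mul_nextDensity hi (Finset.mem_compl.1 hj) hR ω
    _ = marginal D U (A, A) (fun ω => ∑ j ∈ Aᶜ, R (ω j) * q ω) ω := by
        simp only [marginal]
        rw [lintegral_finsetSum _ fun j _ => by
          exact ((hRj j).mul hq.measurable).comp (measurable_splice_right ω)]
    _ ≤ marginal D U (A, A) (fun ω => K * q ω) ω := by
        refine lintegral_mono fun ω' => ?_
        simp only
        rcases eq_or_ne (q (splice (A, A) ω ω')) 0 with h | h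
        · simp [h]
        · rw [← Finset.sum_mul]
          gcongr
          exact (Finset.sum_le_sum_of_subset (Finset.subset_univ _)).trans (hlegal _ h)
    _ = K * marginal D U (A, A) q ω :=
        marginal_mul (g := fun _ => K) hq.measurable (fun _ _ => rfl) ω

/-- Given `A`, the pair of a further point and its corruption has a law `Γ` with expected cost at
most `m / (m - |A|)`, where `m` is the number of indices. Reverting a fraction `τ = |A| / m` makes
the cost legal, and capping the first marginal restores `D`; the resulting `D'` is compared with `Γ`
coordinate by coordinate. -/
theorem conditional_product_le_of_ne_zero (hq : IsExchangeableDensity D U q)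
    (hρ : IsCostFunction ρ) (hG : Measurable G)
    (hlegal : ∀ ω, q ω ≠ 0 → ∑ j, ρ (ω j).1 (G (ω j)) ≤ (Fintype.card ι : ℝ≥0∞))
    (hi : i ∉ A) {n : ℕ} {f : (Fin n → X) → ℝ≥0∞} (hf : Measurable f) (hf1 : ∀ S, f S ≤ 1)
    {O : ℝ≥0∞} (hO : ∀ D' ∈ distCorruptions ρ D, ∫⁻ S, f S ∂(Measure.pi fun _ => D') ≤ O)
    {ω : ι → X × Y} (hω : marginal D U (A, A) q ω ≠ 0) :
    ∫⁻ w, (∏ j, ((marginal D U (A, A) q ω)⁻¹ * nextDensity D U q A i ω (w j))) *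
        f (fun j => G (w j)) ∂(Measure.pi fun _ => D.prod U) ≤
      O + n * (∫⁻ x, ((marginal D U (A, A) q ω)⁻¹ * nextFstDensity D U q A i ω x - 1) ∂D +
        A.card / Fintype.card ι) := by
  set M := marginal D U (A, A) q ω with hM
  have hMtop : M ≠ ∞ := hq.marginal_ne_top ω
  have hφ := hq.measurable_nextDensity (A := A) (i := i) ω
  set p : X × Y → ℝ≥0∞ := fun z => M⁻¹ * nextDensity D U q A i ω z with hp
  have hpm : Measurable p := hφ.const_mul _
  set μ := (D.prod U).withDensity p with hμ
  have hμ1 : IsProbabilityMeasure μ := by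
    refine ⟨?_⟩
    rw [hμ, withDensity_apply _ MeasurableSet.univ, Measure.restrict_univ,
      lintegral_const_mul _ hφ, hq.lintegral_nextDensity hi, ENNReal.inv_mul_cancel hω hMtop]
  have hGm : Measurable fun z : X × Y => (z.1, G z) := measurable_fst.prodMk hG
  set Γ := μ.map fun z => (z.1, G z) with hΓ
  set s : X → ℝ≥0∞ := fun x => M⁻¹ * nextFstDensity D U q A i ω x with hs
  have hsm : Measurable s := (hq.measurable_nextFstDensity ω).const_mul _
  have hfst : Γ.map Prod.fst = D.withDensity s := by
    refine Measure.ext_of_lintegral _ fun g hg => ?_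
    rw [lintegral_map hg measurable_fst, lintegral_map (by fun_prop) hGm,
      lintegral_withDensity_eq_lintegral_mul _ hpm (by fun_prop),
      lintegral_withDensity_eq_lintegral_mul _ hsm hg,
      lintegral_prod _ (by fun_prop)]
    refine lintegral_congr fun x => ?_
    have hx : Measurable fun y => nextDensity D U q A i ω (x, y) := hφ.comp measurable_prodMk_left
    simp only [Pi.mul_apply, hp, hs]
    rw [lintegral_mul_const _ (hx.const_mul _), lintegral_const_mul _ hx,
      hq.lintegral_nextDensity_snd hi]
  have hcardA : A.card ≤ Fintype.card ι := Finset.card_le_univ A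
  have hpos : 0 < Fintype.card ι := Fintype.card_pos_iff.2 ⟨i⟩
  have hm0 : (Fintype.card ι : ℝ≥0∞) ≠ 0 := by exact_mod_cast hpos.ne'
  have hmtop : (Fintype.card ι : ℝ≥0∞) ≠ ∞ := ENNReal.natCast_ne_top _
  have hτ : (A.card : ℝ≥0∞) / Fintype.card ι ≤ 1 :=
    ENNReal.div_le_of_le_mul (by rw [one_mul]; exact_mod_cast hcardA)
  have hu : Measurable (fun p : X × X => ρ p.1 p.2) := hρ.measurable
  have hcost : (1 - (A.card : ℝ≥0∞) / Fintype.card ι) * ∫⁻ p, ρ p.1 p.2 ∂Γ ≤ 1 := by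
    have hR : Measurable fun z : X × Y => ρ z.1 (G z) := hu.comp hGm
    have h1 : ∫⁻ p, ρ p.1 p.2 ∂Γ =
        M⁻¹ * ∫⁻ z, ρ z.1 (G z) * nextDensity D U q A i ω z ∂(D.prod U) := by
      rw [lintegral_map hu hGm, lintegral_withDensity_eq_lintegral_mul _ hpm hR,
        ← lintegral_const_mul _ (by exact hR.mul hφ)]
      refine lintegral_congr fun z => ?_
      simp only [Pi.mul_apply, hp]
      ring
    have h2 := hq.mul_lintegral_cost_le hR hlegal hi ω
    have h3 : (1 - (A.card : ℝ≥0∞) / Fintype.card ι) =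
        (Fintype.card ι : ℝ≥0∞)⁻¹ * ((Fintype.card ι - A.card : ℕ) : ℝ≥0∞) := by
      rw [ENNReal.natCast_sub, ENNReal.mul_sub fun _ _ => ENNReal.inv_ne_top.2 hm0,
        ENNReal.inv_mul_cancel hm0 hmtop, mul_comm, ENNReal.div_eq_inv_mul, mul_comm]
    rw [h1, h3]
    calc _ = (Fintype.card ι : ℝ≥0∞)⁻¹ * M⁻¹ * (((Fintype.card ι - A.card : ℕ) : ℝ≥0∞) *
          ∫⁻ z, ρ z.1 (G z) * nextDensity D U q A i ω z ∂(D.prod U)) := by ring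
      _ ≤ (Fintype.card ι : ℝ≥0∞)⁻¹ * M⁻¹ * (Fintype.card ι * M) := by gcongr
      _ = ((Fintype.card ι : ℝ≥0∞)⁻¹ * Fintype.card ι) * (M⁻¹ * M) := by ring
      _ ≤ 1 := mul_le_one' (ENNReal.inv_mul_le_one _) (ENNReal.inv_mul_le_one _)
  obtain ⟨D', hD', htv⟩ := exists_distCorruption_of_coupling hρ Γ hsm hfst hτ hcost
  have := isProbabilityMeasure_of_mem_distCorruptions hD'
  have hΓsnd : Γ.map Prod.snd = μ.map G := Measure.map_map measurable_snd hGm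
  have : IsProbabilityMeasure (μ.map G) := Measure.isProbabilityMeasure_map hG.aemeasurable
  have hGn : Measurable fun (w : Fin n → X × Y) j => G (w j) := by fun_prop
  calc ∫⁻ w, (∏ j, p (w j)) * f (fun j => G (w j)) ∂(Measure.pi fun _ => D.prod U)
      = ∫⁻ w, f (fun j => G (w j)) ∂(Measure.pi fun _ => μ) :=
        (lintegral_pi_withDensity _ hpm (hf.comp hGn)).symm
    _ = ∫⁻ S, f S ∂(Measure.pi fun _ => μ.map G) := by
        rw [← Measure.pi_map_pi fun _ => hG.aemeasurable, lintegral_map hf hGn]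
    _ ≤ ∫⁻ S, f S ∂(Measure.pi fun _ => D') +
          n * (∫⁻ x, (s x - 1) ∂D + A.card / Fintype.card ι) := by
        refine lintegral_pi_le_add (fun g hg hg1 => ?_) hf hf1
        rw [← hΓsnd, lintegral_map hg measurable_snd]
        exact htv g hg hg1
    _ ≤ _ := by gcongr; exact hO D' hD'

theorem lintegral_conditional_product_le (hq : IsExchangeableDensity D U q)
    (hρ : IsCostFunction ρ) (hG : Measurable G)
    (hlegal : ∀ ω, q ω ≠ 0 → ∑ j, ρ (ω j).1 (G (ω j)) ≤ (Fintype.card ι : ℝ≥0∞))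
    (hi : i ∉ A) {n : ℕ} {f : (Fin n → X) → ℝ≥0∞} (hf : Measurable f) (hf1 : ∀ S, f S ≤ 1)
    {O : ℝ≥0∞} (hO : ∀ D' ∈ distCorruptions ρ D, ∫⁻ S, f S ∂(Measure.pi fun _ => D') ≤ O) :
    ∫⁻ ω, marginal D U (A, A) q ω * ∫⁻ w, (∏ j, ((marginal D U (A, A) q ω)⁻¹ *
        nextDensity D U q A i ω (w j))) * f (fun j => G (w j))
          ∂(Measure.pi fun _ => D.prod U) ∂(iid ι D U) ≤
      O + n * (A.card / Fintype.card ι) +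
        n * ∫⁻ ω, (marginal D U (insert i A, A) q ω - marginal D U (A, A) q ω) ∂(iid ι D U) := by
  have hm : Measurable (marginal D U (A, A) q) := measurable_marginal hq.measurable
  rw [← hq.lintegral_nextFstDensity_sub hi]
  calc _ ≤ ∫⁻ ω, (marginal D U (A, A) q ω * (O + n * (A.card / Fintype.card ι)) +
        n * ∫⁻ x, (nextFstDensity D U q A i ω x - marginal D U (A, A) q ω) ∂D) ∂(iid ι D U) := by
        refine lintegral_mono fun ω => ?_
        simp only
        rcases eq_or_ne (marginal D U (A, A) q ω) 0 with h | h
        · simp [h]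
        refine (mul_le_mul_right (hq.conditional_product_le_of_ne_zero hρ hG hlegal hi hf hf1 hO h)
          _).trans ?_
        have htop := hq.marginal_ne_top (a := (A, A)) ω
        have hcancel : marginal D U (A, A) q ω *
            ∫⁻ x, ((marginal D U (A, A) q ω)⁻¹ * nextFstDensity D U q A i ω x - 1) ∂D =
            ∫⁻ x, (nextFstDensity D U q A i ω x - marginal D U (A, A) q ω) ∂D := by
          rw [← lintegral_const_mul' _ _ htop]
          refine lintegral_congr fun x => ?_
          rw [ENNReal.mul_sub fun _ _ => htop, ← mul_assoc, ENNReal.mul_inv_cancel h htop,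
            one_mul, mul_one]
        rw [← hcancel]
        apply le_of_eq
        ring
    _ = _ := by
        rw [lintegral_add_left (by fun_prop), lintegral_mul_const _ hm,
          lintegral_marginal hq.measurable, hq.lintegral_eq_one, one_mul,
          lintegral_const_mul' _ _ (ENNReal.natCast_ne_top n)]

end IsExchangeableDensity

end ObliviousFromCore

/-! ### Measurable choice of an optimal corruption -/

section Selection

theorem exists_measurable_argmax {Ω Λ : Type*} [MeasurableSpace Ω] [MeasurableSpace Λ]
    {val : Λ → Ω → ℝ≥0∞} (hval : ∀ c, Measurable (val c)) (s : Finset Λ) (hs : s.Nonempty) :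
    ∃ g : Ω → Λ, Measurable g ∧ (Measurable fun ω => val (g ω) ω) ∧
      ∀ c ∈ s, ∀ ω, val c ω ≤ val (g ω) ω := by
  classical
  induction hs using Finset.Nonempty.cons_induction with
  | singleton a => exact ⟨fun _ => a, measurable_const, hval a, by simp⟩
  | cons a s ha hs ih =>
    obtain ⟨g, hg, hgv, hmax⟩ := ih
    have hS : MeasurableSet {ω | val (g ω) ω ≤ val a ω} := measurableSet_le hgv (hval a)
    refine ⟨fun ω => if val (g ω) ω ≤ val a ω then a else g ω,
      Measurable.ite hS measurable_const hg, ?_, fun c hc ω => ?_⟩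
    · have : (fun ω => val (if val (g ω) ω ≤ val a ω then a else g ω) ω) =
          fun ω => if val (g ω) ω ≤ val a ω then val a ω else val (g ω) ω := by
        funext ω; split_ifs <;> rfl
      rw [this]
      exact Measurable.ite hS (hval a) hgv
    · dsimp only
      rcases Finset.mem_cons.1 hc with rfl | hc
      · split_ifs with h
        · exact le_rfl
        · exact (not_le.1 h).le
      · split_ifs with h
        · exact (hmax c hc ω).trans h
        · exact hmax c hc ω

variable {X Y : Type*} [MeasurableSpace X] {ρ : X → X → ℝ≥0∞}

/-- If finitely many Borel functions cover the finite-cost corruptions of a point, an optimal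
legal corruption of a sample can be chosen measurably. -/
theorem exists_measurable_optimal_labels (hρ : IsCostFunction ρ) [Finite Y] [MeasurableSpace Y]
    {g : Y → X → X} (hg : ∀ y, Measurable (g y))
    (hcover : ∀ x x', ρ x x' ≠ ∞ → ∃ y, x' = g y x) {m : ℕ} (hm : 0 < m)
    {F : (Fin m → X) → ℝ≥0∞} (hF : Measurable F) :
    ∃ c : (Fin m → X) → Fin m → Y, Measurable c ∧ ∀ S,
      (fun i => g (c S i) (S i)) ∈ sampleCorruptions ρ S ∧
      ⨆ S' ∈ sampleCorruptions ρ S, F S' ≤ F fun i => g (c S i) (S i) := by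
  classical
  rcases isEmpty_or_nonempty X with hX | hX
  · have : IsEmpty (Fin m → X) := ⟨fun S => hX.false (S ⟨0, hm⟩)⟩
    exact ⟨fun S => isEmptyElim S, measurable_of_empty _, fun S => isEmptyElim S⟩
  have : Nonempty Y := by
    obtain ⟨x⟩ := hX
    obtain ⟨y, -⟩ := hcover x x (by simp [hρ.self_eq_zero])
    exact ⟨y⟩
  have : Fintype Y := Fintype.ofFinite Y
  set T : (Fin m → Y) → (Fin m → X) → Fin m → X := fun c S i => g (c i) (S i) with hT
  have hTm (c) : Measurable (T c) :=
    measurable_pi_lambda _ fun i => (hg (c i)).comp (measurable_pi_apply i)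
  have hTl (c) : MeasurableSet {S | T c S ∈ sampleCorruptions ρ S} :=
    (measurableSet_legal hρ m).preimage (measurable_id.prodMk (hTm c))
  -- Adding `1` makes every legal labelling strictly better than every illegal one, even where `F`
  -- vanishes. A legal labelling always exists, since the identity corruption is legal.
  set val : (Fin m → Y) → (Fin m → X) → ℝ≥0∞ := fun c S =>
    if T c S ∈ sampleCorruptions ρ S then F (T c S) + 1 else 0 with hval
  have hvalm (c) : Measurable (val c) :=
    Measurable.ite (hTl c) ((hF.comp (hTm c)).add_const 1) measurable_const
  obtain ⟨c, hc, -, hmax⟩ := exists_measurable_argmax hvalm Finset.univ Finset.univ_nonempty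
  have hlab (S S' : Fin m → X) (hS' : S' ∈ sampleCorruptions ρ S) : ∃ l, S' = T l S := by
    have h (i) : ∃ y, S' i = g y (S i) := by
      refine hcover _ _ fun htop => ?_
      have h1 := (mem_sampleCorruptions_iff hm).1 hS'
      have h2 : ρ (S i) (S' i) ≤ ∑ i, ρ (S i) (S' i) :=
        Finset.single_le_sum (f := fun i => ρ (S i) (S' i)) (fun _ _ => zero_le)
          (Finset.mem_univ i)
      rw [htop] at h2
      exact absurd (h2.trans h1) (by simp)
    choose l hl using h
    exact ⟨l, funext hl⟩
  have hlegal (S) : T (c S) S ∈ sampleCorruptions ρ S := by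
    obtain ⟨l, hl⟩ := hlab S S (self_mem_sampleCorruptions hρ S)
    by_contra hne
    have h1 := hmax l (Finset.mem_univ l) S
    have h2 : T l S ∈ sampleCorruptions ρ S := hl ▸ self_mem_sampleCorruptions hρ S
    simp [hval, hne, h2] at h1
  refine ⟨c, hc, fun S => ⟨hlegal S, iSup₂_le fun S' hS' => ?_⟩⟩
  obtain ⟨l, rfl⟩ := hlab S S' hS'
  have h1 := hmax l (Finset.mem_univ l) S
  simp only [hval, hS', hlegal S, if_true] at h1
  exact (ENNReal.add_le_add_iff_right ENNReal.one_ne_top).1 h1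

end Selection

/-! ### The symmetrized labelled sample -/

section LabelDensity

variable {ι X Y : Type*} [Fintype ι] [DecidableEq ι] [MeasurableSpace X] [MeasurableSpace Y]

open Classical in
/-- The density, with respect to i.i.d. points with uniform labels, of an i.i.d. sample labelled
by `c`. -/
noncomputable def labelDensity (k : ℝ≥0∞) (c : (ι → X) → ι → Y) (ω : ι → X × Y) : ℝ≥0∞ :=
  if (fun i => (ω i).2) = c (fun i => (ω i).1) then k ^ Fintype.card ι else 0

/-- The symmetrization of a function of a finite family. -/
noncomputable def symmetrize (q : (ι → X × Y) → ℝ≥0∞) (ω : ι → X × Y) : ℝ≥0∞ :=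
  (Fintype.card (Equiv.Perm ι) : ℝ≥0∞)⁻¹ * ∑ σ : Equiv.Perm ι, q (ω ∘ σ)

variable {D : Measure X} {U : Measure Y} [IsProbabilityMeasure D] [IsProbabilityMeasure U]
  {k : ℝ≥0∞} {c : (ι → X) → ι → Y} {q : (ι → X × Y) → ℝ≥0∞}

theorem inv_card_perm_mul_sum_const (r : ℝ≥0∞) :
    (Fintype.card (Equiv.Perm ι) : ℝ≥0∞)⁻¹ * ∑ _σ : Equiv.Perm ι, r = r := by
  rw [Finset.sum_const, nsmul_eq_mul, Finset.card_univ, ← mul_assoc,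
    ENNReal.inv_mul_cancel (Nat.cast_ne_zero.2 Fintype.card_ne_zero) (ENNReal.natCast_ne_top _),
    one_mul]

theorem measurable_labelDensity [Finite Y] [MeasurableSingletonClass Y] (hc : Measurable c) :
    Measurable (labelDensity k c) := by
  classical
  refine Measurable.ite ?_ measurable_const measurable_const
  have : Countable Y := Finite.to_countable
  exact measurableSet_eq_fun (by fun_prop) (hc.comp (by fun_prop))

theorem measurable_symmetrize (hq : Measurable q) : Measurable (symmetrize q) := by
  have h (σ : Equiv.Perm ι) : Measurable fun ω : ι → X × Y => q (ω ∘ σ) :=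
    hq.comp (measurable_comp_index σ)
  have := Finset.measurable_fun_sum (Finset.univ : Finset (Equiv.Perm ι)) fun σ _ => h σ
  exact this.const_mul _

theorem symmetrize_comp_perm (σ : Equiv.Perm ι) (ω : ι → X × Y) :
    symmetrize q (ω ∘ σ) = symmetrize q ω := by
  unfold symmetrize
  congr 1
  exact Fintype.sum_equiv (Equiv.mulLeft σ) _ _ fun τ => rfl

theorem lintegral_labelDensity_snd [Finite Y] [MeasurableSingletonClass Y]
    (hU : ∀ y, U {y} = k⁻¹) (hk0 : k ≠ 0) (hk : k ≠ ∞) (y : ι → Y) :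
    ∫⁻ y', (Set.indicator {y} (fun _ => k ^ Fintype.card ι) y') ∂(Measure.pi fun _ : ι => U) =
      1 := by
  have : Countable Y := Finite.to_countable
  rw [lintegral_indicator_const (measurableSet_singleton y), Measure.pi_singleton]
  simp only [hU, Finset.prod_const, Finset.card_univ]
  rw [← mul_pow, ENNReal.mul_inv_cancel hk0 hk, one_pow]

/-- For fixed points and each permutation, exactly one labelling carries density `k ^ card ι`, and
it has mass `k⁻¹ ^ card ι`; so the points keep their i.i.d. law. -/
theorem isExchangeableDensity_symmetrize [Finite Y] [MeasurableSingletonClass Y]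
    (hU : ∀ y, U {y} = k⁻¹) (hk0 : k ≠ 0) (hk : k ≠ ∞) (hc : Measurable c) :
    IsExchangeableDensity D U (symmetrize (labelDensity k c)) where
  measurable := measurable_symmetrize (measurable_labelDensity hc)
  bounded := by
    refine ⟨k ^ Fintype.card ι, ENNReal.pow_ne_top hk, fun ω => ?_⟩
    rw [← inv_card_perm_mul_sum_const (ι := ι) (k ^ Fintype.card ι)]
    unfold symmetrize
    gcongr
    unfold labelDensity
    split_ifs
    · exact le_rfl
    · exact zero_le
  comp_perm := symmetrize_comp_perm
  marginal_fst := by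
    intro ω
    have hσ (σ : Equiv.Perm ι) : ∫⁻ ω', labelDensity k c (splice (Finset.univ, ∅) ω ω' ∘ σ)
        ∂(iid ι D U) = 1 := by
      set y : ι → Y := c fun i => (ω (σ i)).1
      have h1 (ω' : ι → X × Y) : labelDensity k c (splice (Finset.univ, ∅) ω ω' ∘ σ) =
          Set.indicator {y} (fun _ => k ^ Fintype.card ι) fun i => (ω' (σ i)).2 := by
        have h2 : splice (Finset.univ, ∅) ω ω' ∘ σ =
            fun i => ((ω (σ i)).1, (ω' (σ i)).2) := by funext i; simp [splice]
        rw [h2]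
        by_cases h : (fun i => (ω' (σ i)).2) = y
        · rw [Set.indicator_of_mem (by exact h)]
          exact if_pos h
        · rw [Set.indicator_of_notMem (by exact h)]
          exact if_neg h
      simp only [h1]
      have hmp : MeasurePreserving (fun (ω' : ι → X × Y) i => (ω' i).2) (iid ι D U)
          (Measure.pi fun _ => U) :=
        measurePreserving_pi (f := fun _ => Prod.snd) (fun _ : ι => D.prod U) (fun _ => U)
          fun _ => measurePreserving_snd
      have : Countable Y := Finite.to_countable
      rw [← lintegral_labelDensity_snd hU hk0 hk y]
      exact (hmp.comp (measurePreserving_comp_perm (D := D) (U := U) σ)).lintegral_comp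
        (measurable_const.indicator (measurableSet_singleton y))
    simp only [marginal, symmetrize]
    have hme (σ : Equiv.Perm ι) :
        Measurable fun ω' => labelDensity k c (splice (Finset.univ, ∅) ω ω' ∘ σ) :=
      (measurable_labelDensity hc).comp
        ((measurable_comp_index σ).comp (measurable_splice_right ω))
    rw [lintegral_const_mul _ (Finset.measurable_fun_sum _ fun σ _ => hme σ),
      lintegral_finsetSum _ fun σ _ => hme σ]
    simp only [hσ]
    exact inv_card_perm_mul_sum_const 1

theorem lintegral_law_symmetrize [Finite Y] [MeasurableSingletonClass Y]
    (hU : ∀ y, U {y} = k⁻¹) (hk0 : k ≠ 0) (hk : k ≠ ∞) (hc : Measurable c)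
    {F : (ι → X × Y) → ℝ≥0∞} (hF : Measurable F)
    (hsymm : ∀ (σ : Equiv.Perm ι) ω, F (ω ∘ σ) = F ω) :
    ∫⁻ ω, F ω ∂(law D U (symmetrize (labelDensity k c))) =
      ∫⁻ x, F (fun i => (x i, c x i)) ∂(Measure.pi fun _ => D) := by
  classical
  have hm : Measurable (labelDensity k c) := measurable_labelDensity hc
  have hq := isExchangeableDensity_symmetrize (D := D) hU hk0 hk hc
  have hFm : Measurable fun ω => F ω * labelDensity k c ω := hF.mul hm
  have hFσ (σ : Equiv.Perm ι) : Measurable fun ω : ι → X × Y => F ω * labelDensity k c (ω ∘ σ) :=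
    hF.mul (hm.comp (measurable_comp_index σ))
  have hσ (σ : Equiv.Perm ι) : ∫⁻ ω, F ω * labelDensity k c (ω ∘ σ) ∂(iid ι D U) =
      ∫⁻ ω, F ω * labelDensity k c ω ∂(iid ι D U) := by
    rw [← (measurePreserving_comp_perm (D := D) (U := U) σ).lintegral_comp hFm]
    simp only [hsymm]
  have h1 : ∫⁻ ω, F ω ∂(law D U (symmetrize (labelDensity k c))) =
      ∫⁻ ω, F ω * labelDensity k c ω ∂(iid ι D U) := by
    rw [hq.lintegral_law hF]
    have (ω : ι → X × Y) : F ω * symmetrize (labelDensity k c) ω =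
        (Fintype.card (Equiv.Perm ι) : ℝ≥0∞)⁻¹ *
          ∑ σ : Equiv.Perm ι, F ω * labelDensity k c (ω ∘ σ) := by
      rw [symmetrize, ← Finset.mul_sum]; ring
    simp only [this]
    rw [lintegral_const_mul _ (Finset.measurable_fun_sum _ fun σ _ => hFσ σ),
      lintegral_finsetSum _ fun σ _ => hFσ σ]
    simp only [hσ]
    exact inv_card_perm_mul_sum_const _
  have hz := (measurePreserving_arrowProdEquivProdArrow X Y ι (fun _ => D) fun _ => U).symm
  have : Countable Y := Finite.to_countable
  rw [h1, ← hz.lintegral_comp hFm,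
    lintegral_prod _ (by exact (hFm.comp (MeasurableEquiv.measurable _)).aemeasurable)]
  refine lintegral_congr fun x => ?_
  have h2 (y : ι → Y) : F (fun i => (x i, y i)) * labelDensity k c (fun i => (x i, y i)) =
      F (fun i => (x i, c x i)) * Set.indicator {c x} (fun _ => k ^ Fintype.card ι) y := by
    by_cases h : y = c x
    · subst h; simp [labelDensity]
    · simp [labelDensity, h]
  have h3 : ∫⁻ y, F (fun i => (x i, y i)) * labelDensity k c (fun i => (x i, y i))
      ∂(Measure.pi fun _ => U) = F (fun i => (x i, c x i)) := by
    simp only [h2]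
    rw [lintegral_const_mul _ (measurable_const.indicator (measurableSet_singleton _)),
      lintegral_labelDensity_snd hU hk0 hk, mul_one]
  exact h3

/-- Total cost is permutation invariant, so this transfers legality of the chosen labelling to the
whole support of the symmetrized density. -/
theorem exists_perm_of_symmetrize_ne_zero {ω : ι → X × Y}
    (h : symmetrize (labelDensity k c) ω ≠ 0) :
    ∃ σ : Equiv.Perm ι, (fun i => (ω (σ i)).2) = c fun i => (ω (σ i)).1 := by
  by_contra! hne
  apply h
  have (σ : Equiv.Perm ι) : labelDensity k c (ω ∘ σ) = 0 := by
    simp only [labelDensity, Function.comp_apply]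
    exact if_neg (hne σ)
  simp [symmetrize, this]

end LabelDensity

/-! ### The adaptive value is at most the oblivious value, up to error -/

section AdaptiveLeOblivious

variable {X : Type*} [MeasurableSpace X] {ρ : X → X → ℝ≥0∞}

theorem subsampleAverage_comp_perm {X : Type*} {n m : ℕ} {f : (Fin n → X) → ℝ≥0∞}
    (σ : Equiv.Perm (Fin m)) (S : Fin m → X) :
    subsampleAverage m f (S ∘ σ) = subsampleAverage m f S := by
  unfold subsampleAverage
  congr 1
  exact Fintype.sum_equiv (Equiv.embeddingCongr (Equiv.refl _) σ) _ _ fun e => by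
    congr 1

/-- The uniform distribution on `Fin d`. -/
noncomputable def uniformLabels (d : ℕ) : Measure (Fin d) := (d : ℝ≥0∞)⁻¹ • Measure.count

theorem uniformLabels_singleton {d : ℕ} (y : Fin d) : uniformLabels d {y} = (d : ℝ≥0∞)⁻¹ := by
  simp [uniformLabels]

theorem isProbabilityMeasure_uniformLabels {d : ℕ} (hd : 0 < d) :
    IsProbabilityMeasure (uniformLabels d) := by
  refine ⟨?_⟩
  simp only [uniformLabels, Measure.smul_apply, smul_eq_mul, Measure.count_univ,
    ENat.card_eq_coe_fintype_card,
    Fintype.card_fin]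
  exact ENNReal.inv_mul_cancel (by exact_mod_cast hd.ne') (ENNReal.natCast_ne_top d)

theorem exists_measurable_cover [StandardBorelSpace X] [Nonempty X] (hρ : IsCostFunction ρ)
    {d : ℕ} (hd : degree ρ = d) :
    ∃ g : Fin d → X → X, (∀ j, Measurable (g j)) ∧ ∀ x x', ρ x x' ≠ ∞ → ∃ j, x' = g j x := by
  have hR : MeasurableSet {p : X × X | ρ p.1 p.2 ≠ ∞} :=
    (hρ.measurable (measurableSet_singleton ∞)).compl
  exact exists_measurable_graph_cover d _ hR fun x =>
    hd ▸ le_iSup (fun x => {y : X | ρ x y ≠ ∞}.encard) x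

/-- The three errors come from reverting mass to make the cost legal, from the deviation of a
further point's law from `D` given `A`, and from the failure of conditional independence. -/
theorem adaptive_le_oblivious_add [StandardBorelSpace X] (hρ : IsCostFunction ρ) {d : ℕ}
    (hdeg : degree ρ = d) (hd : 0 < d) {D : Measure X} [IsProbabilityMeasure D] {n m J : ℕ}
    (hn : 0 < n) (hnm : n ≤ m) (hJ : 0 < J) (hnJ : 2 * (n * J) ≤ m)
    {f : (Fin n → X) → ℝ≥0∞} (hf : Measurable f) (hf1 : ∀ S, f S ≤ 1)
    {O : ℝ≥0∞} (hO : ∀ D' ∈ distCorruptions ρ D, ∫⁻ S, f S ∂(Measure.pi fun _ => D') ≤ O)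
    {s t : ℝ} (hs : 0 < s) (ht : 0 < t) :
    ∫⁻ S, ⨆ S' ∈ sampleCorruptions ρ S, subsampleAverage m f S' ∂(Measure.pi fun _ => D) ≤
      O + ENNReal.ofReal (n * (n * J) / m) +
        ENNReal.ofReal (n * (2 * (n * J) * Real.log d / m / s + s)) +
        ENNReal.ofReal (2 * n * Real.log d / J / t + t) := by
  have hm : 0 < m := by omega
  have : Nonempty X := nonempty_of_isProbabilityMeasure D
  obtain ⟨g, hg, hcover⟩ := exists_measurable_cover hρ hdeg
  set F := subsampleAverage m f with hF
  have hFm : Measurable F := measurable_subsampleAverage hf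
  obtain ⟨c, hc, hopt⟩ := exists_measurable_optimal_labels hρ hg hcover hm hFm
  set U := uniformLabels d with hU
  have hUp : IsProbabilityMeasure U := isProbabilityMeasure_uniformLabels hd
  have hUs (y : Fin d) : U {y} = (d : ℝ≥0∞)⁻¹ := uniformLabels_singleton y
  have hd0 : (d : ℝ≥0∞) ≠ 0 := by exact_mod_cast hd.ne'
  have hdtop : (d : ℝ≥0∞) ≠ ∞ := ENNReal.natCast_ne_top d
  have hdr : (0 : ℝ) < d := by exact_mod_cast hd
  have hUr (y : Fin d) : ENNReal.ofReal ((d : ℝ)⁻¹) ≤ U {y} := by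
    rw [hUs, ENNReal.ofReal_inv_of_pos hdr, ENNReal.ofReal_natCast]
  set q : (Fin m → X × Fin d) → ℝ≥0∞ := symmetrize (labelDensity (d : ℝ≥0∞) c) with hqdef
  have hq : IsExchangeableDensity D U q := isExchangeableDensity_symmetrize hUs hd0 hdtop hc
  set G : X × Fin d → X := fun z => g z.2 z.1 with hGdef
  have hG : Measurable G := measurable_from_prod_countable_left fun j => hg j
  have hGm : Measurable fun (ω : Fin m → X × Fin d) i => G (ω i) := by fun_prop
  have hlegal (ω : Fin m → X × Fin d) (hω : q ω ≠ 0) :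
      ∑ j, ρ (ω j).1 (G (ω j)) ≤ (Fintype.card (Fin m) : ℝ≥0∞) := by
    obtain ⟨σ, hσ⟩ := exists_perm_of_symmetrize_ne_zero hω
    have h1 := (mem_sampleCorruptions_iff hm).1 (hopt fun i => (ω (σ i)).1).1
    rw [← hσ] at h1
    rw [Fintype.card_fin, ← Equiv.sum_comp σ fun j => ρ (ω j).1 (G (ω j))]
    exact h1
  have hcard : 2 * (n * J) ≤ Fintype.card (Fin m) := by simpa using hnJ
  obtain ⟨A, e, hA, heA, hpin⟩ := hq.exists_pinning hdr hUr hn hJ hcard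
  have hmr : (0 : ℝ) < m := by exact_mod_cast hm
  have hAr : (A.card : ℝ) ≤ n * J := by exact_mod_cast hA
  have hnJr : 2 * ((n : ℝ) * J) ≤ m := by exact_mod_cast hnJ
  have hlog : 0 ≤ Real.log d := Real.log_natCast_nonneg d
  set i := e ⟨0, hn⟩ with hi
  have hiA : i ∉ A := heA _
  -- Here `|A| ≤ n * J ≤ m / 2`, so at least `m / 2` indices share the information carried by `A`.
  have hfst : entropy D U q (insert i A, A) - entropy D U q (A, A) ≤
      2 * (n * J) * Real.log d / m := by
    have h1 := hq.mul_entropy_increment_fst_le hdr hUr hiA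
    rw [Fintype.card_fin] at h1
    have h2 : (0 : ℝ) ≤ A.card * Real.log d := by positivity
    have h3 : (A.card : ℝ) * Real.log d ≤ n * J * Real.log d := by gcongr
    rw [le_div_iff₀ hmr]
    by_contra hlt
    push Not at hlt
    have h4 : 0 < entropy D U q (insert i A, A) - entropy D U q (A, A) := by
      by_contra hle
      push Not at hle
      have : 0 ≤ 2 * (n * J) * Real.log d := by positivity
      nlinarith
    nlinarith
  have hfG : Measurable fun w : Fin n → X × Fin d => f fun j => G (w j) :=
    hf.comp (by fun_prop)
  have hadapt : ∫⁻ S, ⨆ S' ∈ sampleCorruptions ρ S, F S' ∂(Measure.pi fun _ => D) ≤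
      ∫⁻ ω, f (fun j => G (ω (e j))) ∂(law D U q) := by
    have h1 : ∫⁻ ω, F (fun i => G (ω i)) ∂(law D U q) =
        ∫⁻ ω, f (fun j => G (ω (e j))) ∂(law D U q) := by
      rw [← lintegral_map hFm hGm]
      -- Permutations act transitively on injections, so by exchangeability every subsample has the
      -- same expectation as the one at `e`.
      refine lintegral_subsampleAverage hnm hf fun e' => ?_
      rw [lintegral_map (f := fun S : Fin m → X => f (S ∘ e'))
        (hf.comp (measurable_comp_index e')) hGm]
      have := Equiv.Perm.isMultiplyPretransitive (Fin m) n
      obtain ⟨σ, hσ⟩ := MulAction.exists_smul_eq (Equiv.Perm (Fin m)) e e'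
      have hσ' (j) : e' j = σ (e j) := by rw [← hσ]; rfl
      have hfe : Measurable fun ω : Fin m → X × Fin d => f fun j => G (ω (e j)) :=
        hfG.comp (measurable_comp_index e)
      rw [← (hq.measurePreserving_law σ).lintegral_comp hfe]
      simp only [Function.comp_def, hσ']
    have h2 : ∫⁻ ω, F (fun i => G (ω i)) ∂(law D U q) =
        ∫⁻ x, F (fun i => g (c x i) (x i)) ∂(Measure.pi fun _ => D) :=
      lintegral_law_symmetrize hUs hd0 hdtop hc (F := fun ω => F fun i => G (ω i))
        (hFm.comp hGm) fun σ ω => subsampleAverage_comp_perm σ fun i => G (ω i)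
    rw [← h1, h2]
    exact lintegral_mono fun S => (hopt S).2
  have hcore := hq.lintegral_law_le_conditional_product e heA hiA hfG (fun _ => hf1 _) ht
  have hobl := hq.lintegral_conditional_product_le hρ hG hlegal hiA hf hf1 hO
  refine (hadapt.trans hcore).trans ?_
  gcongr
  refine hobl.trans ?_
  gcongr
  · rw [Fintype.card_fin]
    calc (n : ℝ≥0∞) * (A.card / m) = ENNReal.ofReal (n * (A.card / m)) := by
          rw [ENNReal.ofReal_mul (by positivity), ENNReal.ofReal_div_of_pos hmr]
          simp
      _ ≤ _ := by
          refine ENNReal.ofReal_le_ofReal ?_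
          rw [mul_div_assoc]
          gcongr
  · rw [ENNReal.ofReal_mul (by positivity), ENNReal.ofReal_natCast]
    gcongr
    refine (hq.lintegral_fst_excess_le hs).trans (ENNReal.ofReal_le_ofReal ?_)
    gcongr

end AdaptiveLeOblivious

/-! ### Choice of parameters and conclusion -/

section Equivalence

theorem sample_size_bounds {N L ε M : ℝ} (hN : 1 ≤ N) (hL : 1 / 2 ≤ L) (hε : 0 < ε) (hε1 : ε ≤ 1)
    (hM : 2 ^ 20 * (N ^ 4 * L ^ 2 / ε ^ 4) ≤ M) :
    0 < M ∧ 2 ^ 20 * (N ^ 3 / ε ^ 3) ≤ 4 * (M * ε) ∧ 2 ^ 19 * (N ^ 3 * L / ε ^ 2) ≤ M * ε ∧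
      2 ^ 20 * (N ^ 4 * L ^ 2 / ε ^ 3) ≤ M * ε ∧ 2 ^ 10 * (N ^ 2 * L / ε ^ 2) ≤ M := by
  have hpos : 0 < N ^ 4 * L ^ 2 / ε ^ 4 := by positivity
  have hM0 : 0 < M := by linarith
  have hMe : 2 ^ 20 * (N ^ 4 * L ^ 2 / ε ^ 3) ≤ M * ε := by
    have : N ^ 4 * L ^ 2 / ε ^ 3 = N ^ 4 * L ^ 2 / ε ^ 4 * ε := by field_simp
    rw [this, ← mul_assoc]
    gcongr
  have hL0 : 0 < L := by linarith
  have hN0 : 0 < N := by linarith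
  refine ⟨hM0, ?_, ?_, hMe, ?_⟩
  · have h1 : N ^ 3 / ε ^ 3 ≤ 4 * (N ^ 4 * L ^ 2 / ε ^ 3) := by
      rw [← mul_div_assoc]
      gcongr
      have h2 : N ^ 3 * (1 / 4) ≤ N ^ 4 * L ^ 2 :=
        mul_le_mul (pow_le_pow_right₀ hN (by norm_num)) (by nlinarith) (by norm_num)
          (by positivity)
      linarith
    linarith
  · have h1 : N ^ 3 * L / ε ^ 2 ≤ 2 * (N ^ 4 * L ^ 2 / ε ^ 3) := by
      rw [← mul_div_assoc, div_le_div_iff₀ (by positivity) (by positivity)]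
      have h2 : N ^ 3 * L * ε ^ 3 ≤ N ^ 4 * L * ε ^ 2 := by
        gcongr ?_ * L * ?_
        · exact pow_le_pow_right₀ hN (by norm_num)
        · exact pow_le_pow_of_le_one hε.le hε1 (by norm_num)
      have h3 : N ^ 4 * L * ε ^ 2 * 1 ≤ N ^ 4 * L * ε ^ 2 * (2 * L) := by
        gcongr; linarith
      linarith
    linarith
  · have h1 : N ^ 2 * L / ε ^ 2 ≤ 2 * (N ^ 4 * L ^ 2 / ε ^ 4) := by
      rw [← mul_div_assoc, div_le_div_iff₀ (by positivity) (by positivity)]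
      have h2 : N ^ 2 * L * ε ^ 4 ≤ N ^ 4 * L * ε ^ 2 := by
        gcongr ?_ * L * ?_
        · exact pow_le_pow_right₀ hN (by norm_num)
        · exact pow_le_pow_of_le_one hε.le hε1 (by norm_num)
      have h3 : N ^ 4 * L * ε ^ 2 * 1 ≤ N ^ 4 * L * ε ^ 2 * (2 * L) := by
        gcongr; linarith
      linarith
    linarith

theorem exists_core_size {n m : ℕ} {L ε : ℝ} (hn : 0 < n) (hL : 1 / 2 ≤ L) (hε : 0 < ε)
    (hε1 : ε ≤ 1) (hm : 2 ^ 20 * ((n : ℝ) ^ 4 * L ^ 2 / ε ^ 4) ≤ m) :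
    ∃ J : ℕ, 0 < J ∧ 2 * (n * J) ≤ m ∧
      (n : ℝ) * (n * J) / m + n * (2 * (n * J) * L / m / (ε / (16 * n)) + ε / (16 * n)) +
        (2 * n * L / J / (ε / 16) + ε / 16) ≤ ε := by
  have hN : (1 : ℝ) ≤ n := by exact_mod_cast hn
  obtain ⟨hm0, -, h2, h3, h4⟩ := sample_size_bounds hN hL hε hε1 hm
  set N : ℝ := (n : ℝ) with hNdef
  set M : ℝ := (m : ℝ) with hMdef
  have hN0 : 0 < N := by linarith
  have hL0 : 0 < L := by linarith
  -- Chosen so that `J ≥ x` makes the total correlation term `2 * N * L / J / (ε / 16)` at most `ε /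
  -- 8`. Rounding up at most doubles `x`, because `x ≥ 1`.
  set x : ℝ := 256 * (N * L / ε ^ 2) with hx
  have hx1 : 1 ≤ x := by
    have : 1 / 2 ≤ N * L / ε ^ 2 := by
      rw [le_div_iff₀ (by positivity)]
      have h5 : ε ^ 2 ≤ 1 := pow_le_one₀ hε.le hε1
      nlinarith
    linarith
  refine ⟨⌈x⌉₊, Nat.ceil_pos.2 (by linarith), ?_, ?_⟩
  all_goals
    have hJx : x ≤ (⌈x⌉₊ : ℝ) := Nat.le_ceil x
    have hJ2 : (⌈x⌉₊ : ℝ) ≤ 512 * (N * L / ε ^ 2) := by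
      have := (Nat.ceil_lt_add_one (by linarith : (0 : ℝ) ≤ x)).le
      linarith
  · have : 2 * (N * (⌈x⌉₊ : ℝ)) ≤ M := by
      calc 2 * (N * (⌈x⌉₊ : ℝ)) ≤ 2 * (N * (512 * (N * L / ε ^ 2))) := by gcongr
        _ = 2 ^ 10 * (N ^ 2 * L / ε ^ 2) := by ring
        _ ≤ M := h4
    rw [hNdef, hMdef] at this
    exact_mod_cast this
  · set J : ℝ := (⌈x⌉₊ : ℝ) with hJ
    have hJ0 : 0 < J := by linarith
    have e1 : N * (N * J) / M ≤ ε / 16 := by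
      rw [div_le_iff₀ hm0]
      calc N * (N * J) ≤ N * (N * (512 * (N * L / ε ^ 2))) := by gcongr
        _ = 2 ^ 9 * (N ^ 3 * L / ε ^ 2) := by ring
        _ ≤ ε / 16 * M := by
            have : 0 ≤ N ^ 3 * L / ε ^ 2 := by positivity
            linarith
    have e2 : N * (2 * (N * J) * L / M / (ε / (16 * N)) + ε / (16 * N)) ≤ ε / 8 := by
      have h5 : N * (2 * (N * J) * L / M / (ε / (16 * N)) + ε / (16 * N)) =
          32 * N ^ 3 * J * L / (M * ε) + ε / 16 := by
        field_simp
        ring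
      have h6 : 32 * N ^ 3 * J * L / (M * ε) ≤ ε / 16 := by
        rw [div_le_iff₀ (by positivity)]
        calc 32 * N ^ 3 * J * L ≤ 32 * N ^ 3 * (512 * (N * L / ε ^ 2)) * L := by gcongr
          _ = 2 ^ 14 * (N ^ 4 * L ^ 2 / ε ^ 3) * ε := by field_simp; norm_num
          _ ≤ ε / 16 * (M * ε) := by nlinarith
      linarith
    have e3 : 2 * N * L / J / (ε / 16) ≤ ε / 8 := by
      rw [div_le_iff₀ (by positivity), div_le_iff₀ hJ0]
      calc 2 * N * L = ε / 8 * (ε / 16) * (256 * (N * L / ε ^ 2)) := by field_simp; norm_num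
        _ ≤ ε / 8 * (ε / 16) * J := by gcongr
    linarith

theorem abs_toReal_sub_le {a b : ℝ≥0∞} {ε : ℝ} (ha : a ≤ 1) (hb : b ≤ 1) (hε : 0 ≤ ε)
    (h1 : a ≤ b + ENNReal.ofReal ε) (h2 : b ≤ a + ENNReal.ofReal ε) :
    |a.toReal - b.toReal| ≤ ε := by
  have ha' := ne_top_of_le_ne_top ENNReal.one_ne_top ha
  have hb' := ne_top_of_le_ne_top ENNReal.one_ne_top hb
  have h1' := ENNReal.toReal_mono (by simp [hb']) h1
  have h2' := ENNReal.toReal_mono (by simp [ha']) h2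
  rw [ENNReal.toReal_add hb' (by simp), ENNReal.toReal_ofReal hε] at h1'
  rw [ENNReal.toReal_add ha' (by simp), ENNReal.toReal_ofReal hε] at h2'
  rw [abs_le]
  constructor <;> linarith

theorem obliviousMax_sub_adaptiveMax_le {n d m : ℕ} {ε : ℝ} (hd : 2 ≤ d) (hε : 0 < ε)
    (hnm : n ≤ m) (hm : 2 ^ 20 * ((n : ℝ) ^ 4 * Real.log d ^ 2 / ε ^ 4) ≤ m)
    {X : Type*} [MeasurableSpace X] [StandardBorelSpace X] {ρ : X → X → ℝ≥0∞}
    (hρ : IsCostFunction ρ) (hdeg : degree ρ = d) (F : Kernel (Fin n → X) Bool)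
    [IsMarkovKernel F] (D : Measure X) [IsProbabilityMeasure D] :
    |(obliviousMax ρ F D).toReal - (adaptiveMax ρ (F ∘ₖ subsample X m n) D).toReal| ≤ ε := by
  set f : (Fin n → X) → ℝ≥0∞ := fun S => F S {true} with hfdef
  have hf : Measurable f := F.measurable_coe (measurableSet_singleton true)
  have hf1 (S) : f S ≤ 1 := prob_le_one
  have hcomp (S : Fin m → X) : (F ∘ₖ subsample X m n) S {true} = subsampleAverage m f S := by
    rw [Kernel.comp_apply' _ _ _ (measurableSet_singleton true)]
    exact subsample_lintegral hf S
  set O := obliviousMax ρ F D with hO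
  set B := adaptiveMax ρ (F ∘ₖ subsample X m n) D with hB
  have hBeq : B = ∫⁻ S, ⨆ S' ∈ sampleCorruptions ρ S, subsampleAverage m f S'
      ∂(Measure.pi fun _ : Fin m => D) := by
    simp only [hB, adaptiveMax, hcomp]
  have hOle (D') (hD' : D' ∈ distCorruptions ρ D) :
      ∫⁻ S, f S ∂(Measure.pi fun _ => D') ≤ O :=
    le_iSup₂ (f := fun D' (_ : D' ∈ distCorruptions ρ D) =>
      ∫⁻ S, F S {true} ∂(Measure.pi fun _ : Fin n => D')) D' hD'
  have hO1 : O ≤ 1 := iSup₂_le fun D' hD' => by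
    have := isProbabilityMeasure_of_mem_distCorruptions hD'
    calc _ ≤ ∫⁻ _, 1 ∂(Measure.pi fun _ : Fin n => D') := lintegral_mono hf1
      _ = 1 := by simp
  have hB1 : B ≤ 1 := by
    rw [hBeq]
    calc _ ≤ ∫⁻ _, 1 ∂(Measure.pi fun _ : Fin m => D) :=
          lintegral_mono fun S => iSup₂_le fun S' _ => subsampleAverage_le_one hf1 S'
      _ = 1 := by simp
  rcases le_or_gt 1 ε with hε1 | hε1
  · refine abs_toReal_sub_le hO1 hB1 hε.le (hO1.trans ?_) (hB1.trans ?_)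
    all_goals exact (ENNReal.one_le_ofReal.2 hε1).trans le_add_self
  -- For `n = 0` the size hypothesis does not force `m > 0`; the test is then constant and both
  -- values agree.
  rcases Nat.eq_zero_or_pos n with rfl | hn
  · have hconst (S : Fin 0 → X) : f S = f Fin.elim0 := congrArg f (Subsingleton.elim _ _)
    have hO0 : O = f Fin.elim0 := by
      refine le_antisymm (iSup₂_le fun D' hD' => ?_) (le_trans ?_
        (hOle D (self_mem_distCorruptions hρ D)))
      · have := isProbabilityMeasure_of_mem_distCorruptions hD'
        change ∫⁻ S, f S ∂_ ≤ _
        simp [hconst]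
      · simp [hconst]
    have hB0 : B = f Fin.elim0 := by
      have h (S : Fin m → X) : ⨆ S' ∈ sampleCorruptions ρ S, subsampleAverage m f S' =
          f Fin.elim0 := by
        simp only [subsampleAverage_const hnm fun e => hconst _]
        exact le_antisymm (iSup₂_le fun _ _ => le_rfl)
          (le_iSup₂ (f := fun S' (_ : S' ∈ sampleCorruptions ρ S) => f Fin.elim0) S
            (self_mem_sampleCorruptions hρ S))
      rw [hBeq]
      simp [h]
    rw [hO0, hB0, sub_self, abs_zero]
    exact hε.le
  have hN : (1 : ℝ) ≤ n := by exact_mod_cast hn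
  have hL : 1 / 2 ≤ Real.log d := by
    have h1 : Real.log 2 ≤ Real.log d := Real.log_le_log (by norm_num) (by exact_mod_cast hd)
    have := Real.log_two_gt_d9
    linarith
  obtain ⟨hm0, h1, -⟩ := sample_size_bounds hN hL hε hε1.le hm
  have hmpos : 0 < m := by omega
  refine abs_toReal_sub_le hO1 hB1 hε.le ?_ ?_
  · refine iSup₂_le fun D' hD' => ?_
    -- With `δ = ε / (8n)` and `L = 8n / ε`, the marginal error is `ε / 4` and the Chebyshev error
    -- is `512 n³ / (ε³ m) ≤ ε / 2`.
    have hδ : 0 < ε / (8 * n) := by positivity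
    have hδ1 : ε / (8 * n) ≤ 1 := by
      rw [div_le_one (by positivity)]; linarith
    have hL' : 0 < 8 * n / ε := by positivity
    refine (lintegral_le_adaptive hρ hD' hnm hmpos hf hf1 hδ hδ1 hL').trans ?_
    rw [← hBeq, add_assoc]
    gcongr
    rw [← ENNReal.ofReal_natCast n, ← ENNReal.ofReal_mul (by positivity),
      ← ENNReal.ofReal_add (by positivity) (by positivity)]
    refine ENNReal.ofReal_le_ofReal ?_
    have e1 : (n : ℝ) * (ε / (8 * n) + 1 / (8 * n / ε)) = ε / 4 := by
      field_simp; norm_num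
    have e2 : 8 * n / ε / ((ε / (8 * n)) ^ 2 * m) ≤ ε / 2 := by
      have : 8 * n / ε / ((ε / (8 * n)) ^ 2 * m) = 512 * ((n : ℝ) ^ 3 / ε ^ 3) / m := by
        field_simp; norm_num
      rw [this, div_le_iff₀ hm0]
      have : 0 ≤ (n : ℝ) ^ 3 / ε ^ 3 := by positivity
      linarith
    linarith
  · obtain ⟨J, hJ, hnJ, hle⟩ := exists_core_size hn hL hε hε1.le hm
    rw [hBeq]
    refine (adaptive_le_oblivious_add hρ hdeg (by omega) hn hnm hJ hnJ hf hf1 hOle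
      (s := ε / (16 * n)) (t := ε / 16) (by positivity) (by positivity)).trans ?_
    rw [add_assoc, add_assoc, ← add_assoc (ENNReal.ofReal _), ← ENNReal.ofReal_add (by positivity)
      (by positivity), ← ENNReal.ofReal_add (by positivity) (by positivity)]
    gcongr

end Equivalence

end StatAdversary

theorem theorem2 :
    ∃ C : ℝ, 0 < C ∧
      ∀ (n d m : ℕ) (ε : ℝ), 2 ≤ d → 0 < ε → n ≤ m →
        C * ((n : ℝ) ^ 4 * Real.log d ^ 2 / ε ^ 4) ≤ m →
      ∀ (X : Type*) [MeasurableSpace X] [StandardBorelSpace X] (ρ : X → X → ℝ≥0∞),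
        StatAdversary.IsCostFunction ρ → StatAdversary.degree ρ = d →
        (∀ (f : (Fin n → X) → Bool) (hf : Measurable f) (D : Measure X),
          IsProbabilityMeasure D →
          |(StatAdversary.obliviousMax ρ (Kernel.deterministic f hf) D).toReal -
            (StatAdversary.adaptiveMax ρ
              (Kernel.deterministic f hf ∘ₖ StatAdversary.subsample X m n) D).toReal| ≤ ε) ∧
        (∀ (Y : Type*) [MeasurableSpace Y] (A : Kernel (Fin n → X) Y), IsMarkovKernel A →
          StatAdversary.EpsEquivalent ε ρ A (A ∘ₖ StatAdversary.subsample X m n)) := by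
  -- Both parts are instances of one bound for Markov kernels to `Bool`: the deterministic kernel of
  -- `f`, and `A.map T`, since postprocessing by `T` commutes with subsampling.
  refine ⟨2 ^ 20, by norm_num, fun n d m ε hd hε hnm hm X _ _ ρ hρ hdeg => ⟨?_, ?_⟩⟩
  · intro f hf D hD
    exact StatAdversary.obliviousMax_sub_adaptiveMax_le hd hε hnm hm hρ hdeg _ D
  · intro Y _ A hA T hT D hD
    have := Kernel.IsMarkovKernel.map A hT
    rw [Kernel.map_comp]
    exact StatAdversary.obliviousMax_sub_adaptiveMax_le hd hε hnm hm hρ hdeg _ D
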